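/- Fix integers $d_{\mathrm{in}},w_{\mathrm{cv}},d_{\mathrm{cv}},d_{\mathrm{fc}}\ge 1$ with $w_{\mathrm{cv}}<d_{\mathrm{in}}$ and a real $c>0$. For $w\ge1$ consider the following architecture: $d_{\mathrm{cv}}$ circular one-dimensional convolutional layers on $d_{\mathrm{in}}$ positions (taken modulo $d_{\mathrm{in}}$), with window size $w_{\mathrm{cv}}$, one input channel (the input $x\in\mathbb R^{d_{\mathrm{in}}}$) and $w$ filters per layer, with pre-activations $$q(i,o,l)=\sum_{a=0}^{w_{\mathrm{cv}}-1}\sum_k\Theta(a,k,o,l)\,z(i+a,k,l-1);$$ then global average pooling $z(o)=\frac1{d_{\mathrm{in}}}\sum_i z(i,o,d_{\mathrm{cv}})$; then $d_{\mathrm{fc}}$ fully connected layers, namely $d_{\mathrm{fc}}-1$ hidden layers of width $w$ and a linear scalar output layer. There are no biases. Every hidden convolutional or fully connected unit outputs $z=q\cdot G$, where $q$ is its pre-activation and $G$ its gate. The deep gated network (DGN) consists of two networks of this architecture with separate weights $\Theta^{\mathrm f}$ and $\Theta^{\mathrm v}$. The gating network (weights $\Theta^{\mathrm f}$) is a ReLU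 network: each of its gates is $G=\mathbf 1_{\{q>0\}}$ with $q$ its own pre-activation. The weight network (weights $\Theta^{\mathrm v}$) receives the same input $x$ and uses the gates of the corresponding units of the gating network; its output is $\hat y(x)$. Let $$\mathrm{NTK}^{\mathrm{CONV}}_{(\Theta^{\mathrm f},\Theta^{\mathrm v})}(x,x')=\sum_\theta \partial_\theta\hat y(x)\,\partial_\theta\hat y(x'),$$ the sum running over all the weights in $(\Theta^{\mathrm f},\Theta^{\mathrm v})$. (As the gates are $0/1$-valued, a partial derivative in a weight of the gating network is $0$ wherever it exists; it is counted as $0$ where it does not exist.) A path consists of a position in the input and in each convolutional layer (linked by window offsets), a filter in each convolutional layer, and a unit in each hidden fully connected layer. Its activity $A_{\Theta^{\mathrm f}}(x,p)\in\{0,1\}$ is the product of the gates of the units on it (the pooling factor $1/d_{\mathrm{in}}$ is not included). A bundle is the set of the $d_{\mathrm{in}}$ paths with the same window offsets, filters and units. The neural path feature of a bundle $B$ is $\phi_{\Theta^{\mathrm f}}(x,B)=\sum_{p\in B}x(\text{input position of }p)\,A_{\Theta^{\mathrm f}}(x,p)$, and $$\mathrm{NPK}^{\mathrm{CONV}}_{\Theta^{\mathrm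 f}}(x,x')=\sum_B\phi_{\Theta^{\mathrm f}}(x,B)\,\phi_{\Theta^{\mathrm f}}(x',B).$$ Let $\sigma_{\mathrm{cv}}=c/\sqrt{w\,w_{\mathrm{cv}}}$, $\sigma_{\mathrm{fc}}=c/\sqrt w$ and $$\beta_{\mathrm{cv}}=d_{\mathrm{cv}}\,\sigma_{\mathrm{cv}}^{2(d_{\mathrm{cv}}-1)}\sigma_{\mathrm{fc}}^{2d_{\mathrm{fc}}}+d_{\mathrm{fc}}\,\sigma_{\mathrm{cv}}^{2d_{\mathrm{cv}}}\sigma_{\mathrm{fc}}^{2(d_{\mathrm{fc}}-1)}.$$ For each $w$, let the entries of $\Theta^{\mathrm v}_0$ be independent, each uniform on $\{-\sigma_{\mathrm{cv}},\sigma_{\mathrm{cv}}\}$ in the convolutional layers and on $\{-\sigma_{\mathrm{fc}},\sigma_{\mathrm{fc}}\}$ in the fully connected layers (including the output layer), and let $\Theta^{\mathrm f}_0$ be random with an arbitrary law and independent of $\Theta^{\mathrm v}_0$. Then, for all $x,x'\in\mathbb R^{d_{\mathrm{in}}}$, as $w\to\infty$, $$\mathrm{NTK}^{\mathrm{CONV}}_{(\Theta^{\mathrm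 f}_0,\Theta^{\mathrm v}_0)}(x,x')-\frac{\beta_{\mathrm{cv}}}{d_{\mathrm{in}}^2}\,\mathrm{NPK}^{\mathrm{CONV}}_{\Theta^{\mathrm f}_0}(x,x')\longrightarrow 0$$ in mean square and in probability. -/

import Mathlib

open Filter Topology MeasureTheory ProbabilityTheory
open scoped ENNReal

noncomputable section

namespace ConvDGN

/-- The width-independent data of the convolutional architecture: `dcv` circular convolutional
layers with window size `wcv` on `din` positions, then global average pooling, then `dfc` fully
connected layers (`dfc - 1` hidden ones and the scalar output layer). -/
structure Arch where
  din : ℕ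
  wcv : ℕ
  dcv : ℕ
  dfc : ℕ
  wcv_pos : 0 < wcv
  wcv_lt : wcv < din
  dcv_pos : 0 < dcv
  dfc_pos : 0 < dfc

/-- Index set of the scalar weights of the network with `w` filters per convolutional layer and
`w` units per hidden fully connected layer. -/
inductive WIdx (A : Arch) (w : ℕ) : Type
  /-- first convolutional layer (one input channel): window offset, output filter -/
  | first (a : Fin A.wcv) (o : Fin w)
  /-- convolutional layer `l + 2`: window offset, input filter, output filter -/
  | conv (l : Fin (A.dcv - 1)) (a : Fin A.wcv) (k o : Fin w)
  /-- `(l + 1)`-st hidden fully connected layer: input unit, output unit -/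
  | fc (l : Fin (A.dfc - 1)) (k o : Fin w)
  /-- output layer: input unit -/
  | out (k : Fin w)

/-- The weights, listed layer type by layer type. -/
def WIdx.equivSum (A : Arch) (w : ℕ) : WIdx A w ≃
    (Fin A.wcv × Fin w) ⊕ (Fin (A.dcv - 1) × Fin A.wcv × Fin w × Fin w) ⊕
      (Fin (A.dfc - 1) × Fin w × Fin w) ⊕ Fin w where
  toFun
    | .first a o => .inl (a, o)
    | .conv l a k o => .inr (.inl (l, a, k, o))
    | .fc l k o => .inr (.inr (.inl (l, k, o)))
    | .out k => .inr (.inr (.inr k))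
  invFun
    | .inl (a, o) => .first a o
    | .inr (.inl (l, a, k, o)) => .conv l a k o
    | .inr (.inr (.inl (l, k, o))) => .fc l k o
    | .inr (.inr (.inr k)) => .out k
  left_inv e := by cases e <;> rfl
  right_inv e := by rcases e with _ | _ | _ | _ <;> rfl

instance (A : Arch) (w : ℕ) : Fintype (WIdx A w) := Fintype.ofEquiv _ (WIdx.equivSum A w).symm

instance (A : Arch) (w : ℕ) : DecidableEq (WIdx A w) := (WIdx.equivSum A w).decidableEq

/-- Weight vectors `Θ`. -/
abbrev Params (A : Arch) (w : ℕ) : Type := WIdx A w → ℝ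

/-- Inputs `x`. -/
abbrev Input (A : Arch) : Type := Fin A.din → ℝ

/-- The circular shift `i ⊕ r` of a position (positions are `0, …, n - 1`). -/
def cshift {n : ℕ} (i : Fin n) (r : ℕ) : Fin n :=
  ⟨(i.val + r) % n, Nat.mod_lt _ i.pos⟩

variable {A : Arch} {w : ℕ}

/-! ### Linear maps of the layers -/

/-- Pre-activation of the first convolutional layer. -/
def firstLin (Θ : Params A w) (x : Input A) (i : Fin A.din) (o : Fin w) : ℝ :=
  ∑ a : Fin A.wcv, Θ (.first a o) * x (cshift i a)

/-- Pre-activation of convolutional layer `l + 2`, given the previous hidden outputs `z`. -/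
def convLin (Θ : Params A w) (l : Fin (A.dcv - 1)) (z : Fin A.din → Fin w → ℝ)
    (i : Fin A.din) (o : Fin w) : ℝ :=
  ∑ a : Fin A.wcv, ∑ k : Fin w, Θ (.conv l a k o) * z (cshift i a) k

/-- Global average pooling. -/
def pool (z : Fin A.din → Fin w → ℝ) (o : Fin w) : ℝ :=
  ∑ i : Fin A.din, z i o * (1 / (A.din : ℝ))

/-- Pre-activation of the `(l + 1)`-st hidden fully connected layer. -/
def fcLin (Θ : Params A w) (l : Fin (A.dfc - 1)) (z : Fin w → ℝ) (o : Fin w) : ℝ :=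
  ∑ k : Fin w, Θ (.fc l k o) * z k

/-- The scalar output layer (linear, no gate). -/
def outLin (Θ : Params A w) (z : Fin w → ℝ) : ℝ :=
  ∑ k : Fin w, Θ (.out k) * z k

/-! ### The gating network: a convolutional ReLU network -/

/-- The hard gate `𝟙{q > 0}`. -/
def hardGate (q : ℝ) : ℝ := if 0 < q then 1 else 0

/-- Pre-activations of convolutional layer `l + 1` of the ReLU network with weights `Θ`. -/
def reluConvPre (Θ : Params A w) (x : Input A) :
    (l : ℕ) → l < A.dcv → Fin A.din → Fin w → ℝ
  | 0, _ => firstLin Θ x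
  | l + 1, h => convLin Θ ⟨l, by omega⟩ fun i k =>
      reluConvPre Θ x l (by omega) i k * hardGate (reluConvPre Θ x l (by omega) i k)

/-- Output of the pooling layer of the ReLU network. -/
def reluPool (Θ : Params A w) (x : Input A) : Fin w → ℝ :=
  pool fun i k =>
    reluConvPre Θ x (A.dcv - 1) (Nat.sub_lt A.dcv_pos one_pos) i k *
      hardGate (reluConvPre Θ x (A.dcv - 1) (Nat.sub_lt A.dcv_pos one_pos) i k)

/-- Pre-activations of the `(l + 1)`-st hidden fully connected layer of the ReLU network. -/
def reluFcPre (Θ : Params A w) (x : Input A) :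
    (l : ℕ) → l < A.dfc - 1 → Fin w → ℝ
  | 0, h => fcLin Θ ⟨0, h⟩ (reluPool Θ x)
  | l + 1, h => fcLin Θ ⟨l + 1, h⟩ fun k =>
      reluFcPre Θ x l (by omega) k * hardGate (reluFcPre Θ x l (by omega) k)

/-- A gating signal for all hidden units. -/
structure Gates (A : Arch) (w : ℕ) where
  conv : Fin A.dcv → Fin A.din → Fin w → ℝ
  fc : Fin (A.dfc - 1) → Fin w → ℝ

/-- The gates produced by the gating network with weights `Θ` on input `x`. -/
def gatesOf (Θ : Params A w) (x : Input A) : Gates A w where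
  conv l i o := hardGate (reluConvPre Θ x l l.isLt i o)
  fc l o := hardGate (reluFcPre Θ x l l.isLt o)

/-! ### The weight network: same architecture, gated linear units -/

/-- Hidden outputs of convolutional layer `l + 1` of the weight network. -/
def galuConv (G : Gates A w) (Θ : Params A w) (x : Input A) :
    (l : ℕ) → l < A.dcv → Fin A.din → Fin w → ℝ
  | 0, h => fun i o => firstLin Θ x i o * G.conv ⟨0, h⟩ i o
  | l + 1, h => fun i o =>
      convLin Θ ⟨l, by omega⟩ (galuConv G Θ x l (by omega)) i o * G.conv ⟨l + 1, h⟩ i o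

/-- Output of the pooling layer (`l = 0`) and of the `l`-th hidden fully connected layer
(`l ≥ 1`) of the weight network. -/
def galuFc (G : Gates A w) (Θ : Params A w) (x : Input A) :
    (l : ℕ) → l ≤ A.dfc - 1 → Fin w → ℝ
  | 0, _ => pool (galuConv G Θ x (A.dcv - 1) (Nat.sub_lt A.dcv_pos one_pos))
  | l + 1, h => fun o => fcLin Θ ⟨l, h⟩ (galuFc G Θ x l (by omega)) o * G.fc ⟨l, h⟩ o

/-- Output of the weight network under the gating signal `G`. -/
def galuOut (G : Gates A w) (Θ : Params A w) (x : Input A) : ℝ :=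
  outLin Θ (galuFc G Θ x (A.dfc - 1) le_rfl)

/-- Output of the convolutional DGN. Its weights are `Θ = (Θᶠ, Θᵛ)`: those of the gating network
(`Sum.inl`) and those of the weight network (`Sum.inr`). -/
def dgnOut (Θ : WIdx A w ⊕ WIdx A w → ℝ) (x : Input A) : ℝ :=
  galuOut (gatesOf (fun e => Θ (.inl e)) x) (fun e => Θ (.inr e)) x

/-! ### Neural tangent kernel -/

/-- The partial derivative of `f` in coordinate `e` at `Θ`. -/
def partialDeriv {ι : Type*} [DecidableEq ι] (f : (ι → ℝ) → ℝ) (Θ : ι → ℝ) (e : ι) : ℝ :=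
  deriv (fun t : ℝ => f (Function.update Θ e t)) (Θ e)

/-- The NTK `⟨∇_Θ ŷ(x), ∇_Θ ŷ(x')⟩` of the DGN, over all its weights. The output is a polynomial
in `Θᵛ`. As a function of a coordinate of `Θᶠ` it takes finitely many values (the gates are hard),
so that its derivative is `0` wherever it exists; it counts as `0` elsewhere. -/
def ntkConv (Θ : WIdx A w ⊕ WIdx A w → ℝ) (x x' : Input A) : ℝ :=
  ∑ e, partialDeriv (fun Θ => dgnOut Θ x) Θ e * partialDeriv (fun Θ => dgnOut Θ x') Θ e

/-! ### Neural path kernel -/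

/-- A bundle of paths sharing all their weights: the window offsets and the filters in the
convolutional layers and the units in the hidden fully connected layers. -/
abbrev Bundle (A : Arch) (w : ℕ) : Type :=
  (Fin A.dcv → Fin A.wcv) × (Fin A.dcv → Fin w) × (Fin (A.dfc - 1) → Fin w)

/-- A bundle contains `din` paths, one for each node `j` of the last convolutional layer.
`pathPos b j l` is the position of that path in layer `l` (`l = 0` is the input layer): going back
from `j`, each convolutional layer adds its window offset, so that the position in layer `l` is
`j ⊕` the sum of the offsets of the layers `l + 1, …, dcv`. -/
def pathPos (b : Bundle A w) (j : Fin A.din) (l : ℕ) : Fin A.din :=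
  cshift j (∑ m : Fin A.dcv, if l ≤ m.val then (b.1 m).val else 0)

/-- The activity of a path for input `x`: `1` if all its gates are on, and `0` otherwise. -/
def pathActivity (Θ : Params A w) (x : Input A) (b : Bundle A w) (j : Fin A.din) : ℝ :=
  (∏ l : Fin A.dcv, (gatesOf Θ x).conv l (pathPos b j (l.val + 1)) (b.2.1 l)) *
    ∏ l : Fin (A.dfc - 1), (gatesOf Θ x).fc l (b.2.2 l)

/-- The neural path feature of a bundle: sum over its paths of input times activity. -/
def npf (Θ : Params A w) (x : Input A) (b : Bundle A w) : ℝ :=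
  ∑ j : Fin A.din, x (pathPos b j 0) * pathActivity Θ x b j

/-- The neural path kernel: the inner product of the neural path feature vectors. -/
def npkConv (Θ : Params A w) (x x' : Input A) : ℝ :=
  ∑ b : Bundle A w, npf Θ x b * npf Θ x' b

/-! ### Initialisation -/

/-- `σ_cv = c / √(w · wcv)`. -/
def sigmaCv (A : Arch) (c : ℝ) (w : ℕ) : ℝ := c / √((w : ℝ) * (A.wcv : ℝ))

/-- `σ_fc = c / √w`. -/
def sigmaFc (c : ℝ) (w : ℕ) : ℝ := c / √(w : ℝ)

/-- The scale `σ` of each weight. -/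
def scale (c : ℝ) : WIdx A w → ℝ
  | .first _ _ => sigmaCv A c w
  | .conv _ _ _ _ => sigmaCv A c w
  | .fc _ _ _ => sigmaFc c w
  | .out _ => sigmaFc c w

/-- The uniform distribution on `{-σ, +σ}`. -/
def signLaw (σ : ℝ) : Measure ℝ :=
  (2⁻¹ : ℝ≥0∞) • Measure.dirac (-σ) + (2⁻¹ : ℝ≥0∞) • Measure.dirac σ

/-- The constant `β_cv`. -/
def betaCv (A : Arch) (c : ℝ) (w : ℕ) : ℝ :=
  A.dcv * sigmaCv A c w ^ (2 * (A.dcv - 1)) * sigmaFc c w ^ (2 * A.dfc) +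
    A.dfc * sigmaCv A c w ^ (2 * A.dcv) * sigmaFc c w ^ (2 * (A.dfc - 1))

end ConvDGN

end

namespace ConvDGN

/-! ### Layered path systems -/

/-! Unrolling the layers writes the output as a sum over bundles `b` of `npf / din` times the
product of the weights along `b` (`galuOut_eq_sum`). The weights are shared across positions, so the
paths of a bundle enter only through its feature. The hard gates contribute no derivative in the
gating weights. Hence the NTK is a sum over pairs of bundles and gaps in which the two bundles share
a weight, each term carrying the two products of the remaining weights
(`PathSystem.sum_deriv_mul_deriv`).

On the diagonal these products are squared. Since each weight is a sign times a fixed scale, the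
squares are deterministic, and summing over the gap gives `betaCv`. So the diagonal equals the NPK
term almost surely, and the difference in the theorem is the off-diagonal sum
(`ntkConv_sub_eq_offDiag`).

For its second moment, expand the square into quadruples of bundles. The features depend on the
gating weights only and are bounded independently of `w`, so by independence a quadruple contributes
only if every weight has even multiplicity. This forces the four edges to be paired in every gap
(`PathSystem.paired_of_even_mult`), hence also the four nodes in every layer: at most `3 * w ^ 2`
choices per layer. Over `N` hidden layers this is exactly balanced by the scale `sigmaFc ^ (4 * N)`,
of order `w ^ (-2 * N)`.

The decay comes from one more constraint (`PathSystem.Bad.exists_node_eq`): the first two bundles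
are distinct but share an edge, so in some layer they pass between shared and unshared edges, and
there all four nodes coincide. That layer has `w` choices in place of order `w ^ 2`, and the second
moment is O(1/w). Chebyshev's inequality then gives convergence in probability. -/

/-- Paths through `N` layers of `w` nodes. A path has an edge in each of the `N + 1` gaps between
consecutive layers and is determined by its nodes together with a tag in `K`. An edge determines
its gap and its end nodes. -/
structure PathSystem (B I K : Type*) (N w : ℕ) where
  edge : B → Fin (N + 1) → I
  node : B → Fin N → Fin w
  tag : B → K
  ext_node : ∀ b b', tag b = tag b' → node b = node b' → b = b'
  ext_edge : ∀ b b', (∀ l, edge b l = edge b' l) → b = b'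
  layer_eq : ∀ b b' l l', edge b l = edge b' l' → l = l'
  node_castSucc : ∀ b b' (j : Fin N), edge b j.castSucc = edge b' j.castSucc → node b j = node b' j
  node_succ : ∀ b b' (j : Fin N), edge b j.succ = edge b' j.succ → node b j = node b' j

/-- Four elements can be matched in two pairs of equal elements. -/
def Paired {α : Type*} (u v x y : α) : Prop :=
  (u = v ∧ x = y) ∨ (u = x ∧ v = y) ∨ (u = y ∧ v = x)

instance {α : Type*} [DecidableEq α] (u v x y : α) : Decidable (Paired u v x y) :=
  inferInstanceAs (Decidable (_ ∨ _))

theorem card_paired_le (w : ℕ) :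
    (Finset.univ.filter fun t : Fin w × Fin w × Fin w × Fin w =>
      Paired t.1 t.2.1 t.2.2.1 t.2.2.2).card ≤ 3 * w ^ 2 := by
  -- One of the three pairings together with the two values that remain free.
  let f : Fin 3 × Fin w × Fin w → Fin w × Fin w × Fin w × Fin w := fun p =>
    if p.1 = 0 then (p.2.1, p.2.1, p.2.2, p.2.2)
    else if p.1 = 1 then (p.2.1, p.2.2, p.2.1, p.2.2) else (p.2.1, p.2.2, p.2.2, p.2.1)
  calc _ ≤ (Finset.univ.image f).card := by
        refine Finset.card_le_card ?_
        rintro ⟨a, b, c, d⟩ h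
        simp only [Finset.mem_filter, Finset.mem_univ, true_and, Finset.mem_image] at h ⊢
        rcases h with ⟨h1, h2⟩ | ⟨h1, h2⟩ | ⟨h1, h2⟩
        · exact ⟨(0, a, c), by simp_all [f]⟩
        · exact ⟨(1, a, b), by simp_all [f]⟩
        · exact ⟨(2, a, b), by simp_all [f]⟩
    _ ≤ Fintype.card (Fin 3 × Fin w × Fin w) := Finset.card_image_le
    _ = 3 * w ^ 2 := by simp [sq]

theorem card_all_equal_le (w : ℕ) :
    (Finset.univ.filter fun t : Fin w × Fin w × Fin w × Fin w =>
      t.1 = t.2.1 ∧ t.1 = t.2.2.1 ∧ t.1 = t.2.2.2).card ≤ w := by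
  calc _ ≤ (Finset.univ.image fun a : Fin w => (a, a, a, a)).card := by
        refine Finset.card_le_card ?_
        rintro ⟨a, b, c, d⟩ h
        obtain ⟨rfl, rfl, rfl⟩ : a = b ∧ a = c ∧ a = d := by simpa using h
        simp
    _ ≤ Fintype.card (Fin w) := Finset.card_image_le
    _ = w := by simp

/-- Each value must occur twice or four times among the four entries; testing the values `u`, `v`
and `x` is enough. -/
theorem paired_of_even {I : Type*} [DecidableEq I] {u v x y : I}
    (h : ∀ e, Even ((if u = e then 1 else 0) + (if v = e then 1 else 0) +
      (if x = e then 1 else 0) + (if y = e then 1 else 0))) : Paired u v x y := by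
  have hu := h u
  have hx := h x
  have hv := h v
  unfold Paired
  by_cases h1 : u = v <;> by_cases h2 : x = y <;> by_cases h3 : u = x <;> by_cases h4 : v = y <;>
    by_cases h5 : u = y <;> by_cases h6 : v = x <;>
    simp_all [eq_comm, Nat.even_iff]

/-! ### Counting the quadruples with nonzero expectation -/

namespace PathSystem

variable {B I K : Type*} {N w : ℕ} (P : PathSystem B I K N w)

/-- All edges of the four paths are paired, the first two are distinct and share an edge. -/
def Bad (q : B × B × B × B) : Prop :=
  (∀ l, Paired (P.edge q.1 l) (P.edge q.2.1 l) (P.edge q.2.2.1 l) (P.edge q.2.2.2 l)) ∧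
    (∃ l, P.edge q.1 l = P.edge q.2.1 l) ∧ q.1 ≠ q.2.1

theorem Bad.paired_node {P : PathSystem B I K N w} {q : B × B × B × B} (h : P.Bad q) (j : Fin N) :
    Paired (P.node q.1 j) (P.node q.2.1 j) (P.node q.2.2.1 j) (P.node q.2.2.2 j) := by
  rcases h.1 j.castSucc with h | h | h
  · exact .inl ⟨P.node_castSucc _ _ j h.1, P.node_castSucc _ _ j h.2⟩
  · exact .inr (.inl ⟨P.node_castSucc _ _ j h.1, P.node_castSucc _ _ j h.2⟩)
  · exact .inr (.inr ⟨P.node_castSucc _ _ j h.1, P.node_castSucc _ _ j h.2⟩)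

/-- This is the source of the factor `1 / w`. Two distinct paths that share an edge switch somewhere
between shared and unshared edges. The pairings on the two sides of that layer differ, and both
constrain its four nodes, which must then all agree. -/
theorem Bad.exists_node_eq {P : PathSystem B I K N w} {q : B × B × B × B} (h : P.Bad q) :
    ∃ j, P.node q.1 j = P.node q.2.1 j ∧ P.node q.1 j = P.node q.2.2.1 j ∧
      P.node q.1 j = P.node q.2.2.2 j := by
  obtain ⟨b₁, b₂, b₃, b₄⟩ := q
  obtain ⟨hp, ⟨l₀, hl₀⟩, hne⟩ := h
  by_contra! hno
  simp only at hp hl₀ hne hno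
  -- If only one of the gaps around layer `j` is shared, it gives the pairing 12|34 of the nodes and
  -- the other gap gives 13|24 or 14|23. Together they make all four nodes equal, against `hno`.
  have step : ∀ j : Fin N, P.edge b₁ j.castSucc = P.edge b₂ j.castSucc ↔
      P.edge b₁ j.succ = P.edge b₂ j.succ := by
    intro j
    have c₁₂ := P.node_castSucc b₁ b₂ j
    have c₁₃ := P.node_castSucc b₁ b₃ j
    have c₁₄ := P.node_castSucc b₁ b₄ j
    have c₂₃ := P.node_castSucc b₂ b₃ j
    have c₂₄ := P.node_castSucc b₂ b₄ j
    have c₃₄ := P.node_castSucc b₃ b₄ j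
    have s₁₂ := P.node_succ b₁ b₂ j
    have s₁₃ := P.node_succ b₁ b₃ j
    have s₁₄ := P.node_succ b₁ b₄ j
    have s₂₃ := P.node_succ b₂ b₃ j
    have s₂₄ := P.node_succ b₂ b₄ j
    have s₃₄ := P.node_succ b₃ b₄ j
    have hn := hno j
    have h1 := hp j.castSucc
    have h2 := hp j.succ
    unfold Paired at h1 h2
    constructor <;> intro hj <;> by_contra hj' <;> grind
  have all : ∀ l, P.edge b₁ 0 = P.edge b₂ 0 ↔ P.edge b₁ l = P.edge b₂ l := by
    intro l
    induction l using Fin.induction with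
    | zero => rfl
    | succ j ih => exact ih.trans (step j)
  exact hne (P.ext_edge _ _ fun l => (all l).1 ((all l₀).2 hl₀))

open Classical in
-- A quadruple is encoded by its tags and its node quadruple in each layer. All layers are paired
-- and one layer `j` is constant; a union bound over `j` gives the factor `N`. The factor `w` stands
-- on the left to avoid division in ℕ.
theorem card_bad_mul_le [Fintype B] [Fintype K] :
    (Finset.univ.filter P.Bad).card * w ≤ N * (Fintype.card K ^ 4 * (3 * w ^ 2) ^ N) := by
  let S : Fin N → Fin N → Finset (Fin w × Fin w × Fin w × Fin w) := fun j i =>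
    if i = j then Finset.univ.filter fun t => t.1 = t.2.1 ∧ t.1 = t.2.2.1 ∧ t.1 = t.2.2.2
    else Finset.univ.filter fun t => Paired t.1 t.2.1 t.2.2.1 t.2.2.2
  let T : Fin N → Finset ((K × K × K × K) × (Fin N → Fin w × Fin w × Fin w × Fin w)) := fun j =>
    Finset.univ ×ˢ Fintype.piFinset (S j)
  let f : B × B × B × B → (K × K × K × K) × (Fin N → Fin w × Fin w × Fin w × Fin w) := fun q =>
    ((P.tag q.1, P.tag q.2.1, P.tag q.2.2.1, P.tag q.2.2.2),
      fun i => (P.node q.1 i, P.node q.2.1 i, P.node q.2.2.1 i, P.node q.2.2.2 i))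
  have hf : Function.Injective f := by
    rintro ⟨b₁, b₂, b₃, b₄⟩ ⟨b₁', b₂', b₃', b₄'⟩ h
    simp only [f, Prod.mk.injEq, funext_iff] at h
    obtain ⟨⟨h1, h2, h3, h4⟩, h⟩ := h
    rw [P.ext_node _ _ h1 (funext fun i => (h i).1), P.ext_node _ _ h2 (funext fun i => (h i).2.1),
      P.ext_node _ _ h3 (funext fun i => (h i).2.2.1),
      P.ext_node _ _ h4 (funext fun i => (h i).2.2.2)]
  have hsub : ((Finset.univ.filter P.Bad).image f) ⊆ Finset.univ.biUnion T := by
    intro t ht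
    obtain ⟨q, hq, rfl⟩ := Finset.mem_image.1 ht
    have hq : P.Bad q := (Finset.mem_filter.1 hq).2
    obtain ⟨j, hj⟩ := hq.exists_node_eq
    refine Finset.mem_biUnion.2 ⟨j, Finset.mem_univ _, Finset.mem_product.2 ⟨Finset.mem_univ _, ?_⟩⟩
    refine Fintype.mem_piFinset.2 fun i => ?_
    by_cases hij : i = j
    · subst hij
      simpa [S, f] using hj
    · simpa [S, f, hij] using hq.paired_node i
  have hT : ∀ j, (T j).card * w ≤ Fintype.card K ^ 4 * (3 * w ^ 2) ^ N := by
    intro j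
    have hprod : (∏ i, (S j i).card) * w ≤ (3 * w ^ 2) ^ N := by
      rw [← Finset.mul_prod_erase _ _ (Finset.mem_univ j)]
      have h1 : (S j j).card * w ≤ 3 * w ^ 2 := by
        have : (S j j).card ≤ w := by simpa [S] using card_all_equal_le w
        nlinarith
      have h2 : ∏ i ∈ Finset.univ.erase j, (S j i).card ≤ (3 * w ^ 2) ^ (N - 1) := by
        refine (Finset.prod_le_pow_card _ _ (3 * w ^ 2) fun i hi => ?_).trans (by simp)
        simpa [S, Finset.ne_of_mem_erase hi] using card_paired_le w
      calc _ = (S j j).card * w * ∏ i ∈ Finset.univ.erase j, (S j i).card := by ring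
        _ ≤ (3 * w ^ 2) * (3 * w ^ 2) ^ (N - 1) := Nat.mul_le_mul h1 h2
        _ = (3 * w ^ 2) ^ N := by rw [← pow_succ', Nat.sub_add_cancel j.pos]
    calc (T j).card * w = Fintype.card K ^ 4 * ((∏ i, (S j i).card) * w) := by
          simp only [T, Finset.card_product, Fintype.card_piFinset, Finset.card_univ,
            Fintype.card_prod]
          ring
      _ ≤ _ := Nat.mul_le_mul_left _ hprod
  calc (Finset.univ.filter P.Bad).card * w
      = ((Finset.univ.filter P.Bad).image f).card * w := by rw [Finset.card_image_of_injective _ hf]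
    _ ≤ (∑ j, (T j).card) * w :=
        Nat.mul_le_mul_right _ ((Finset.card_le_card hsub).trans Finset.card_biUnion_le)
    _ = ∑ j, (T j).card * w := Finset.sum_mul ..
    _ ≤ ∑ _j : Fin N, Fintype.card K ^ 4 * (3 * w ^ 2) ^ N := Finset.sum_le_sum fun j _ => hT j
    _ = _ := by simp

/-- The product of the weights of a path, except for the one in gap `l`. -/
noncomputable def punctured (Θ : I → ℝ) (b : B) (l : Fin (N + 1)) : ℝ :=
  ∏ k ∈ Finset.univ.erase l, Θ (P.edge b k)

/-- The multiplicity of the weight `e` in `punctured`. -/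
def mult [DecidableEq I] (b : B) (l : Fin (N + 1)) (e : I) : ℕ :=
  ∑ k ∈ Finset.univ.erase l, if P.edge b k = e then 1 else 0

theorem punctured_eq_prod_pow [Fintype I] [DecidableEq I] (Θ : I → ℝ) (b : B) (l : Fin (N + 1)) :
    P.punctured Θ b l = ∏ e, Θ e ^ P.mult b l e := by
  simp only [mult, ← Finset.prod_pow_eq_pow_sum]
  rw [Finset.prod_comm]
  refine Finset.prod_congr rfl fun k _ => ?_
  simp [pow_ite]

/-- An edge determines its gap, so only the index `k = m` can contribute and multiplicities are 0 or
1. -/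
theorem mult_edge [DecidableEq I] (b c : B) (l m : Fin (N + 1)) :
    P.mult b l (P.edge c m) = if m = l then 0 else if P.edge b m = P.edge c m then 1 else 0 := by
  unfold mult
  have : ∀ k ∈ Finset.univ.erase l, k ≠ m →
      (if P.edge b k = P.edge c m then 1 else 0) = 0 := fun k _ hk =>
    if_neg fun h => hk (P.layer_eq _ _ _ _ h)
  by_cases hm : m = l
  · rw [if_pos hm]
    exact Finset.sum_eq_zero fun k hk => this k hk (hm ▸ Finset.ne_of_mem_erase hk)
  · rw [if_neg hm]
    exact Finset.sum_eq_single_of_mem m (by simp [hm]) this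

/-- Evenness is known only for the punctured paths. The edges removed at `l` and `l'` are equal in
pairs, so restoring them does not change any parity. -/
theorem paired_of_even_mult [DecidableEq I] {b₁ b₂ b₃ b₄ : B} {l l' : Fin (N + 1)}
    (h : P.edge b₁ l = P.edge b₂ l) (h' : P.edge b₃ l' = P.edge b₄ l')
    (heven : ∀ e, Even (P.mult b₁ l e + P.mult b₂ l e + P.mult b₃ l' e + P.mult b₄ l' e))
    (m : Fin (N + 1)) :
    Paired (P.edge b₁ m) (P.edge b₂ m) (P.edge b₃ m) (P.edge b₄ m) := by
  refine paired_of_even fun e => ?_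
  by_cases he : ∃ c, P.edge c m = e
  · obtain ⟨c, rfl⟩ := he
    have := heven (P.edge c m)
    simp only [mult_edge] at this
    by_cases hm : m = l <;> by_cases hm' : m = l' <;>
      simp only [hm, hm', if_true, if_false] at this ⊢
    · subst hm hm'
      rw [h, h', add_assoc]
      exact (Even.add_self _).add (Even.add_self _)
    · subst hm
      rw [h, add_assoc]
      refine (Even.add_self _).add ?_
      simpa [hm'] using this
    · subst hm'
      rw [h', add_assoc]
      refine Even.add ?_ (Even.add_self _)
      simpa [hm] using this
    · simpa [hm, hm'] using this
  · push Not at he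
    simp [he]

end PathSystem

/-! ### Moments of independent signs -/

theorem integral_pow_signLaw (σ : ℝ) {n : ℕ} (hn : Odd n) : ∫ x, x ^ n ∂signLaw σ = 0 := by
  rw [signLaw, integral_add_measure, integral_smul_measure, integral_smul_measure, integral_dirac,
    integral_dirac, hn.neg_pow]
  · simp
  · exact (integrable_dirac (by simp)).smul_measure (by simp)
  · exact (integrable_dirac (by simp)).smul_measure (by simp)

theorem ae_abs_eq_signLaw (σ : ℝ) : ∀ᵐ x ∂signLaw σ, |x| = |σ| := by
  rw [signLaw, ae_add_measure_iff]
  constructor <;> refine Measure.ae_smul_measure ?_ _ <;> simp [ae_dirac_eq]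

/-- By independence the integral factors over the coordinates, and an odd moment of a symmetric sign
is zero. -/
theorem integral_prod_pow_eq_zero {Ω I : Type*} [MeasurableSpace Ω] [Fintype I] {μ : Measure Ω}
    {X : Ω → I → ℝ} (hX : Measurable X) (hiid : iIndepFun (fun e ω => X ω e) μ) {n : I → ℕ} {e : I}
    {σ : ℝ} (hlaw : μ.map (fun ω => X ω e) = signLaw σ) (hn : Odd (n e)) :
    ∫ ω, ∏ i, X ω i ^ n i ∂μ = 0 := by
  have hXe : ∀ i, Measurable fun ω => X ω i := fun i => (measurable_pi_apply i).comp hX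
  rw [hiid.integral_fun_prod_comp (f := fun i x => x ^ n i) (fun i => (hXe i).aemeasurable)
    (fun i => (measurable_id.pow_const _).aestronglyMeasurable)]
  refine Finset.prod_eq_zero (Finset.mem_univ e) ?_
  rw [← integral_map (f := fun x : ℝ => x ^ n e) (hXe e).aemeasurable
    (measurable_id.pow_const _).aestronglyMeasurable, hlaw, integral_pow_signLaw _ hn]

theorem ae_abs_le_of_signLaw {Ω I : Type*} [MeasurableSpace Ω] [Fintype I] {μ : Measure Ω}
    {X : Ω → I → ℝ} (hX : Measurable X) {σ : I → ℝ}
    (hlaw : ∀ e, μ.map (fun ω => X ω e) = signLaw (σ e)) {s : ℝ} (hσ : ∀ e, |σ e| ≤ s) :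
    ∀ᵐ ω ∂μ, ∀ e, |X ω e| ≤ s := by
  refine ae_all_iff.2 fun e => ?_
  have := ae_of_ae_map ((measurable_pi_apply e).comp hX).aemeasurable
    ((hlaw e).symm ▸ ae_abs_eq_signLaw (σ e) : ∀ᵐ x ∂μ.map (fun ω => X ω e), |x| = |σ e|)
  filter_upwards [this] with ω hω
  exact hω.le.trans (hσ e)

/-! ### Second moment of the off-diagonal sum -/

namespace PathSystem

variable {B I K : Type*} {N w : ℕ} (P : PathSystem B I K N w)

theorem abs_punctured_le {Θ : I → ℝ} {s : ℝ} (h : ∀ e, |Θ e| ≤ s) (b : B) (l : Fin (N + 1)) :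
    |P.punctured Θ b l| ≤ s ^ N := by
  rw [punctured, Finset.abs_prod]
  calc _ ≤ ∏ k ∈ Finset.univ.erase l, s :=
        Finset.prod_le_prod (fun _ _ => abs_nonneg _) fun k _ => h _
    _ = s ^ N := by simp

theorem measurable_punctured (b : B) (l : Fin (N + 1)) :
    Measurable fun Θ : I → ℝ => P.punctured Θ b l := by
  unfold punctured
  fun_prop

theorem integral_punctured_eq_zero {Ω : Type*} [MeasurableSpace Ω] [Fintype I] {μ : Measure Ω}
    {X : Ω → I → ℝ} (hX : Measurable X) (hiid : iIndepFun (fun e ω => X ω e) μ) {σ : I → ℝ}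
    (hlaw : ∀ e, μ.map (fun ω => X ω e) = signLaw (σ e)) {b₁ b₂ b₃ b₄ : B} {l l' : Fin (N + 1)}
    (hne : b₁ ≠ b₂) (h : P.edge b₁ l = P.edge b₂ l) (h' : P.edge b₃ l' = P.edge b₄ l')
    (hbad : ¬ P.Bad (b₁, b₂, b₃, b₄)) :
    ∫ ω, (P.punctured (X ω) b₁ l * P.punctured (X ω) b₂ l) *
      (P.punctured (X ω) b₃ l' * P.punctured (X ω) b₄ l') ∂μ = 0 := by
  classical
  obtain ⟨e, he⟩ : ∃ e,
      Odd (P.mult b₁ l e + P.mult b₂ l e + P.mult b₃ l' e + P.mult b₄ l' e) := by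
    by_contra! hcon
    exact hbad ⟨P.paired_of_even_mult h h' fun e => Nat.not_odd_iff_even.1 (hcon e), ⟨l, h⟩, hne⟩
  have key := integral_prod_pow_eq_zero hX hiid (hlaw e) he
    (n := fun e => P.mult b₁ l e + P.mult b₂ l e + P.mult b₃ l' e + P.mult b₄ l' e)
  rw [← key]
  refine integral_congr_ae (.of_forall fun ω => ?_)
  simp only [punctured_eq_prod_pow, ← Finset.prod_mul_distrib, pow_add]
  exact Finset.prod_congr rfl fun i _ => by ring

/-- The off-diagonal part of a sum over pairs of paths sharing an edge. -/
noncomputable def offDiag [Fintype B] [DecidableEq B] [DecidableEq I] (a a' : B → ℝ) (Θ : I → ℝ) :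
    ℝ :=
  ∑ t : (B × B) × Fin (N + 1) with t.1.1 ≠ t.1.2 ∧ P.edge t.1.1 t.2 = P.edge t.1.2 t.2,
    a t.1.1 * a' t.1.2 * (P.punctured Θ t.1.1 t.2 * P.punctured Θ t.1.2 t.2)

theorem memLp_offDiag {Ω Γ : Type*} [MeasurableSpace Ω] [MeasurableSpace Γ] [Fintype I]
    [DecidableEq I] [Fintype B] [DecidableEq B] {μ : Measure Ω} [IsProbabilityMeasure μ]
    {X : Ω → I → ℝ} (hX : Measurable X) {σ : I → ℝ}
    (hlaw : ∀ e, μ.map (fun ω => X ω e) = signLaw (σ e)) {s : ℝ} (hσ : ∀ e, |σ e| ≤ s)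
    {Y : Ω → Γ} (hY : Measurable Y) {a a' : Γ → B → ℝ}
    (ha : ∀ b, Measurable fun y => a y b) (ha' : ∀ b, Measurable fun y => a' y b) {R : ℝ}
    (hR : ∀ y b, |a y b| ≤ R) (hR' : ∀ y b, |a' y b| ≤ R) :
    MemLp (fun ω => P.offDiag (a (Y ω)) (a' (Y ω)) (X ω)) 2 μ := by
  refine memLp_finsetSum _ fun t _ => MemLp.of_bound ?_ (R * R * (s ^ N * s ^ N)) ?_
  · exact ((((ha _).comp hY).mul ((ha' _).comp hY)).mul
      (((P.measurable_punctured _ _).comp hX).mul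
        ((P.measurable_punctured _ _).comp hX))).aestronglyMeasurable
  · filter_upwards [ae_abs_le_of_signLaw hX hlaw hσ] with ω hω
    simp only [Real.norm_eq_abs, abs_mul]
    have h1 := mul_le_mul (hR (Y ω) t.1.1) (hR' (Y ω) t.1.2) (abs_nonneg _)
      ((abs_nonneg _).trans (hR (Y ω) t.1.1))
    have h2 := mul_le_mul (P.abs_punctured_le hω t.1.1 t.2) (P.abs_punctured_le hω t.1.2 t.2)
      (abs_nonneg _) ((abs_nonneg _).trans (P.abs_punctured_le hω t.1.1 t.2))
    exact mul_le_mul h1 h2 (by positivity) (mul_self_nonneg R)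

theorem sum_pairs_sum_pairs [Fintype B] (g : B × B × B × B → ℝ) :
    ∑ t : (B × B) × Fin (N + 1), ∑ t' : (B × B) × Fin (N + 1), g (t.1.1, t.1.2, t'.1.1, t'.1.2) =
      (N + 1) ^ 2 * ∑ q, g q := by
  simp only [Fintype.sum_prod_type, Finset.sum_const, Finset.card_univ, Fintype.card_fin,
    nsmul_eq_mul, ← Finset.mul_sum]
  push_cast
  ring

open Classical in
-- The coefficients depend on `Y` and the weight products on `X`, so each expectation factors and
-- vanishes off `Bad`. The remaining terms are bounded in absolute value; `(N + 1) ^ 2` counts the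
-- two punctured gaps.
theorem integral_offDiag_sq_le {Ω Γ : Type*} [MeasurableSpace Ω] [MeasurableSpace Γ] [Fintype I]
    [Fintype B] {μ : Measure Ω} [IsProbabilityMeasure μ]
    {X : Ω → I → ℝ} (hX : Measurable X) (hiid : iIndepFun (fun e ω => X ω e) μ) {σ : I → ℝ}
    (hlaw : ∀ e, μ.map (fun ω => X ω e) = signLaw (σ e)) {s : ℝ} (hσ : ∀ e, |σ e| ≤ s)
    {Y : Ω → Γ} (hY : Measurable Y) (hYX : IndepFun Y X μ) {a a' : Γ → B → ℝ}
    (ha : ∀ b, Measurable fun y => a y b) (ha' : ∀ b, Measurable fun y => a' y b) {R : ℝ}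
    (hR : ∀ y b, |a y b| ≤ R) (hR' : ∀ y b, |a' y b| ≤ R) :
    ∫ ω, P.offDiag (a (Y ω)) (a' (Y ω)) (X ω) ^ 2 ∂μ ≤
      R ^ 4 * s ^ (4 * N) * ((N + 1) ^ 2 * (Finset.univ.filter P.Bad).card) := by
  have hXs := ae_abs_le_of_signLaw hX hlaw hσ
  let A : (B × B) × Fin (N + 1) → Γ → ℝ := fun t y => a y t.1.1 * a' y t.1.2
  let M : (B × B) × Fin (N + 1) → (I → ℝ) → ℝ := fun t Θ =>
    P.punctured Θ t.1.1 t.2 * P.punctured Θ t.1.2 t.2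
  have hA : ∀ t, Measurable (A t) := fun t => (ha _).mul (ha' _)
  have hM : ∀ t, Measurable (M t) := fun t =>
    (P.measurable_punctured _ _).mul (P.measurable_punctured _ _)
  have hAb : ∀ t y, |A t y| ≤ R * R := fun t y => by
    rw [abs_mul]
    exact mul_le_mul (hR _ _) (hR' _ _) (abs_nonneg _) ((abs_nonneg _).trans (hR y t.1.1))
  have hMb : ∀ᵐ ω ∂μ, ∀ t, |M t (X ω)| ≤ s ^ N * s ^ N := by
    filter_upwards [hXs] with ω hω t
    rw [abs_mul]
    exact mul_le_mul (P.abs_punctured_le hω _ _) (P.abs_punctured_le hω _ _) (abs_nonneg _)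
      ((abs_nonneg _).trans (P.abs_punctured_le hω t.1.1 t.2))
  have hbound : ∀ t t', ∀ᵐ ω ∂μ,
      ‖(A t (Y ω) * A t' (Y ω)) * (M t (X ω) * M t' (X ω))‖ ≤ R ^ 4 * s ^ (4 * N) := by
    intro t t'
    filter_upwards [hMb] with ω hω
    have h1 := mul_le_mul (hAb t (Y ω)) (hAb t' (Y ω)) (abs_nonneg _) (mul_self_nonneg R)
    have h2 := mul_le_mul (hω t) (hω t') (abs_nonneg _) (mul_self_nonneg (s ^ N))
    rw [← abs_mul] at h1 h2
    have h3 := mul_le_mul h1 h2 (abs_nonneg _) (mul_nonneg (mul_self_nonneg _) (mul_self_nonneg _))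
    rw [← abs_mul] at h3
    refine h3.trans_eq ?_
    ring
  have hint : ∀ t t', Integrable
      (fun ω => (A t (Y ω) * A t' (Y ω)) * (M t (X ω) * M t' (X ω))) μ := fun t t' =>
    Integrable.of_bound
      ((((hA t).comp hY).mul ((hA t').comp hY)).mul
        (((hM t).comp hX).mul ((hM t').comp hX))).aestronglyMeasurable _ (hbound t t')
  let S : Finset ((B × B) × Fin (N + 1)) :=
    {t | t.1.1 ≠ t.1.2 ∧ P.edge t.1.1 t.2 = P.edge t.1.2 t.2}
  have hsq : ∀ ω, P.offDiag (a (Y ω)) (a' (Y ω)) (X ω) ^ 2 =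
      ∑ t ∈ S, ∑ t' ∈ S, (A t (Y ω) * A t' (Y ω)) * (M t (X ω) * M t' (X ω)) := by
    intro ω
    rw [offDiag, sq, Finset.sum_mul_sum]
    exact Finset.sum_congr rfl fun t _ => Finset.sum_congr rfl fun t' _ => by simp only [A, M]; ring
  have hterm : ∀ t ∈ S, ∀ t' ∈ S,
      ∫ ω, (A t (Y ω) * A t' (Y ω)) * (M t (X ω) * M t' (X ω)) ∂μ ≤
        if P.Bad (t.1.1, t.1.2, t'.1.1, t'.1.2) then R ^ 4 * s ^ (4 * N) else 0 := by
    intro t ht t' ht'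
    split_ifs with hb
    · refine (Real.le_norm_self _).trans
        ((norm_integral_le_of_norm_le_const (hbound t t')).trans ?_)
      simp
    · rw [hYX.integral_fun_comp_mul_comp (f := fun y => A t y * A t' y)
        (g := fun Θ => M t Θ * M t' Θ) hY.aemeasurable hX.aemeasurable
        ((hA t).mul (hA t')).aestronglyMeasurable ((hM t).mul (hM t')).aestronglyMeasurable,
        P.integral_punctured_eq_zero hX hiid hlaw (Finset.mem_filter.1 ht).2.1
          (Finset.mem_filter.1 ht).2.2 (Finset.mem_filter.1 ht').2.2 hb, mul_zero]
  -- The signs of `R` and `s` are not known here (the index types may be empty), but both exponents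
  -- are even.
  have hpos : 0 ≤ R ^ 4 * s ^ (4 * N) := by
    have h := mul_nonneg (sq_nonneg (R ^ 2)) (sq_nonneg (s ^ (2 * N)))
    rwa [← pow_mul, ← pow_mul, mul_right_comm 2 N 2] at h
  calc ∫ ω, P.offDiag (a (Y ω)) (a' (Y ω)) (X ω) ^ 2 ∂μ
      = ∑ t ∈ S, ∑ t' ∈ S, ∫ ω, (A t (Y ω) * A t' (Y ω)) * (M t (X ω) * M t' (X ω)) ∂μ := by
        simp only [hsq]
        rw [integral_finsetSum _ fun t _ => integrable_finsetSum _ fun t' _ => hint t t']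
        exact Finset.sum_congr rfl fun t _ => integral_finsetSum _ fun t' _ => hint t t'
    _ ≤ ∑ t ∈ S, ∑ t' ∈ S,
          if P.Bad (t.1.1, t.1.2, t'.1.1, t'.1.2) then R ^ 4 * s ^ (4 * N) else 0 :=
        Finset.sum_le_sum fun t ht => Finset.sum_le_sum fun t' ht' => hterm t ht t' ht'
    -- The bounds are nonnegative and do not involve the gaps, so the restriction to `S` can be
    -- dropped.
    _ ≤ ∑ t : (B × B) × Fin (N + 1), ∑ t' : (B × B) × Fin (N + 1),
          if P.Bad (t.1.1, t.1.2, t'.1.1, t'.1.2) then R ^ 4 * s ^ (4 * N) else 0 := by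
        refine (Finset.sum_le_sum fun t _ => Finset.sum_le_univ_sum_of_nonneg fun t' => ?_).trans
          (Finset.sum_le_univ_sum_of_nonneg fun t => Finset.sum_nonneg fun t' _ => ?_) <;>
        split_ifs <;> first | exact hpos | exact le_rfl
    _ = (N + 1) ^ 2 * ∑ q : B × B × B × B, if P.Bad q then R ^ 4 * s ^ (4 * N) else 0 := by
        exact sum_pairs_sum_pairs fun q => if P.Bad q then R ^ 4 * s ^ (4 * N) else 0
    _ = _ := by
        rw [← Finset.sum_filter, Finset.sum_const, nsmul_eq_mul]
        ring

end PathSystem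

variable {A : Arch} {w : ℕ}

/-! ### The path system of the architecture -/

/-- The nodes of a bundle, numbered through all hidden layers. -/
def bundleNode (b : Bundle A w) (j : ℕ) (h : j < A.dcv + (A.dfc - 1)) : Fin w :=
  if h' : j < A.dcv then b.2.1 ⟨j, h'⟩ else b.2.2 ⟨j - A.dcv, by omega⟩

/-- The weights of a bundle, numbered through all layers. -/
def bundleEdge (b : Bundle A w) (l : Fin (A.dcv + (A.dfc - 1) + 1)) : WIdx A w :=
  have hA := A.dcv_pos
  if h0 : l.val = 0 then .first (b.1 ⟨0, hA⟩) (bundleNode b 0 (by omega))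
  else if h1 : l.val < A.dcv then
    .conv ⟨l.val - 1, by omega⟩ (b.1 ⟨l, h1⟩) (bundleNode b (l.val - 1) (by omega))
      (bundleNode b l (by omega))
  else if h2 : l.val < A.dcv + (A.dfc - 1) then
    .fc ⟨l.val - A.dcv, by omega⟩ (bundleNode b (l.val - 1) (by omega)) (bundleNode b l h2)
  else .out (bundleNode b (l.val - 1) (by omega))

theorem bundle_ext {b b' : Bundle A w} (h : b.1 = b'.1)
    (h' : ∀ j hj, bundleNode b j hj = bundleNode b' j hj) : b = b' := by
  refine Prod.ext h (Prod.ext (funext fun j => ?_) (funext fun j => ?_))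
  · have := h' j (by omega)
    simpa [bundleNode] using this
  · have := h' (A.dcv + j) (by omega)
    simpa [bundleNode] using this

/-- Gap `j.castSucc` enters node `j` and gap `j.succ` leaves it; either weight therefore determines
the node. -/
theorem bundleNode_eq_of_edge_castSucc {b b' : Bundle A w} (j : Fin (A.dcv + (A.dfc - 1)))
    (h : bundleEdge b j.castSucc = bundleEdge b' j.castSucc) :
    bundleNode b j j.2 = bundleNode b' j j.2 := by
  obtain ⟨j, hj⟩ := j
  unfold bundleEdge at h
  simp only [Fin.castSucc_mk] at h
  split_ifs at h with h0 h1
  · subst h0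
    simpa using (WIdx.first.inj h).2
  · exact (WIdx.conv.inj h).2.2.2
  · exact (WIdx.fc.inj h).2.2

theorem bundleNode_eq_of_edge_succ {b b' : Bundle A w} (j : Fin (A.dcv + (A.dfc - 1)))
    (h : bundleEdge b j.succ = bundleEdge b' j.succ) :
    bundleNode b j j.2 = bundleNode b' j j.2 := by
  obtain ⟨j, hj⟩ := j
  unfold bundleEdge at h
  simp only [Fin.succ_mk, Nat.add_eq_zero_iff, one_ne_zero, and_false, dite_false,
    Nat.add_sub_cancel] at h
  split_ifs at h with h0 h1
  · exact (WIdx.conv.inj h).2.2.1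
  · exact (WIdx.fc.inj h).2.1
  · exact WIdx.out.inj h

theorem offset_eq_of_edge {b b' : Bundle A w} (j : Fin A.dcv)
    (h : bundleEdge b ⟨j, by omega⟩ = bundleEdge b' ⟨j, by omega⟩) : b.1 j = b'.1 j := by
  obtain ⟨j, hj⟩ := j
  unfold bundleEdge at h
  simp only at h
  split_ifs at h with h0
  · subst h0
    exact (WIdx.first.inj h).1
  · exact (WIdx.conv.inj h).2.1

theorem layer_eq_of_edge {b b' : Bundle A w} (l l' : Fin (A.dcv + (A.dfc - 1) + 1))
    (h : bundleEdge b l = bundleEdge b' l') : l = l' := by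
  unfold bundleEdge at h
  ext
  split_ifs at h <;> first
    | omega
    | (have := congrArg Fin.val (WIdx.conv.inj h).1; simp only at this; omega)
    | (have := congrArg Fin.val (WIdx.fc.inj h).1; simp only at this; omega)

/-- The bundles of the architecture as a path system. -/
def bundleSystem (A : Arch) (w : ℕ) :
    PathSystem (Bundle A w) (WIdx A w) (Fin A.dcv → Fin A.wcv) (A.dcv + (A.dfc - 1)) w where
  edge := bundleEdge
  node b j := bundleNode b j j.2
  tag b := b.1
  ext_node _ _ h h' := bundle_ext h fun j hj => congrFun h' ⟨j, hj⟩
  ext_edge _ _ h := bundle_ext (funext fun j => offset_eq_of_edge j (h _)) fun j hj =>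
    bundleNode_eq_of_edge_castSucc ⟨j, hj⟩ (h _)
  layer_eq _ _ := layer_eq_of_edge
  node_castSucc _ _ := bundleNode_eq_of_edge_castSucc
  node_succ _ _ := bundleNode_eq_of_edge_succ

/-! ### Path expansion of the output -/

theorem cshift_zero {n : ℕ} (i : Fin n) : cshift i 0 = i := by
  ext
  simp [cshift, Nat.mod_eq_of_lt i.2]

theorem cshift_cshift {n : ℕ} (i : Fin n) (r s : ℕ) : cshift (cshift i r) s = cshift i (s + r) := by
  ext
  simp [cshift, add_assoc, add_comm s r]

/-- The position in layer `r` of the path with offsets and filters `p` that ends at `i`. -/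
def convPos {l : ℕ} (i : Fin A.din) (p : Fin (l + 1) → Fin A.wcv × Fin w) (r : ℕ) : Fin A.din :=
  cshift i (∑ m : Fin (l + 1), if r ≤ m.val then (p m).1.val else 0)

/-- Positions are traced back from the end of the path, so a new last layer only shifts the end
point of the shorter path. The bound on `r` ensures that the new offset is counted. -/
theorem convPos_snoc {l : ℕ} (i : Fin A.din) (p : Fin (l + 1) → Fin A.wcv × Fin w)
    (q : Fin A.wcv × Fin w) {r : ℕ} (hr : r ≤ l + 1) :
    convPos i (Fin.snoc p q : Fin (l + 2) → Fin A.wcv × Fin w) r =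
      convPos (cshift i q.1) p r := by
  rw [convPos, convPos, cshift_cshift, Fin.sum_univ_castSucc]
  simp [hr]

theorem convPos_last {l : ℕ} (i : Fin A.din) (p : Fin (l + 1) → Fin A.wcv × Fin w) :
    convPos i p (l + 1) = i := by
  rw [convPos, Finset.sum_eq_zero, cshift_zero]
  intro m _
  rw [if_neg (by omega)]

/-- The contribution of one path to the output of a convolutional layer. -/
noncomputable def convTerm (G : Gates A w) (Θ : Params A w) (x : Input A) (l : ℕ) (h : l < A.dcv)
    (i : Fin A.din) (p : Fin (l + 1) → Fin A.wcv × Fin w) : ℝ :=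
  (Θ (.first (p 0).1 (p 0).2) *
      ∏ m : Fin l, Θ (.conv ⟨m, by omega⟩ (p m.succ).1 (p m.castSucc).2 (p m.succ).2)) *
    ((∏ m : Fin (l + 1), G.conv ⟨m, by omega⟩ (convPos i p (m + 1)) (p m).2) * x (convPos i p 0))

theorem convTerm_snoc (G : Gates A w) (Θ : Params A w) (x : Input A) (l : ℕ) (h : l + 1 < A.dcv)
    (i : Fin A.din) (p : Fin (l + 1) → Fin A.wcv × Fin w) (q : Fin A.wcv × Fin w) :
    convTerm G Θ x (l + 1) h i (Fin.snoc p q) =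
      Θ (.conv ⟨l, by omega⟩ q.1 (p (Fin.last l)).2 q.2) *
        convTerm G Θ x l (by omega) (cshift i q.1) p * G.conv ⟨l + 1, h⟩ i q.2 := by
  have h0 : (Fin.snoc p q : Fin (l + 2) → Fin A.wcv × Fin w) 0 = p 0 :=
    Fin.snoc_castSucc (α := fun _ => Fin A.wcv × Fin w) q p 0
  have hG : ∀ m : Fin (l + 1),
      convPos i (Fin.snoc p q : Fin (l + 2) → Fin A.wcv × Fin w) (m + 1) =
        convPos (cshift i q.1) p (m + 1) := fun m => convPos_snoc i p q (by omega)
  rw [convTerm, convTerm, Fin.prod_univ_castSucc, Fin.prod_univ_castSucc (n := l + 1),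
    convPos_snoc _ _ _ (Nat.zero_le _), h0]
  simp only [← Fin.castSucc_succ, Fin.snoc_castSucc, Fin.val_castSucc, Fin.succ_last, Fin.snoc_last,
    Fin.val_last, hG, convPos_last]
  ring

theorem sum_snoc {X : Type*} [Fintype X] {n : ℕ} (f : (Fin (n + 1) → X) → ℝ) :
    ∑ p, f p = ∑ q : X, ∑ p : Fin n → X, f (Fin.snoc p q : Fin (n + 1) → X) := by
  rw [← (Fin.snocEquiv fun _ => X).sum_comp, Fintype.sum_prod_type]
  rfl

theorem sum_cons {X : Type*} [Fintype X] {n : ℕ} (f : (Fin (n + 1) → X) → ℝ) :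
    ∑ p, f p = ∑ q : X, ∑ p : Fin n → X, f (Fin.cons q p : Fin (n + 1) → X) := by
  rw [← (Fin.consEquiv fun _ => X).sum_comp, Fintype.sum_prod_type]
  rfl

theorem galuConv_eq_sum (G : Gates A w) (Θ : Params A w) (x : Input A) (l : ℕ) (h : l < A.dcv)
    (i : Fin A.din) (o : Fin w) :
    galuConv G Θ x l h i o = ∑ p : Fin (l + 1) → Fin A.wcv × Fin w,
      if (p (Fin.last l)).2 = o then convTerm G Θ x l h i p else 0 := by
  induction l generalizing i o with
  | zero =>
    rw [← (Equiv.funUnique (Fin 1) (Fin A.wcv × Fin w)).symm.sum_comp, Fintype.sum_prod_type]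
    simp only [galuConv, firstLin, Finset.sum_mul]
    refine Finset.sum_congr rfl fun a _ => ?_
    rw [Finset.sum_eq_single_of_mem o (Finset.mem_univ _)]
    · simp [convTerm, convPos, cshift_zero]
      ring
    · intro k _ hk
      simp [hk]
  | succ l ih =>
    rw [sum_snoc, Fintype.sum_prod_type]
    simp only [galuConv, convLin, ih, Finset.sum_mul, Fin.snoc_last, convTerm_snoc]
    refine Finset.sum_congr rfl fun a _ => ?_
    symm
    rw [Finset.sum_eq_single_of_mem o (Finset.mem_univ _) fun k _ hk => by simp [hk]]
    simp only [if_true, Finset.mul_sum, Finset.sum_mul]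
    symm
    rw [Finset.sum_comm]
    refine Finset.sum_congr rfl fun p _ => ?_
    simp

theorem galuFc_eq_sum (G : Gates A w) (Θ : Params A w) (x : Input A) (l : ℕ) (h : l ≤ A.dfc - 1)
    (o : Fin w) :
    galuFc G Θ x l h o = ∑ ν : Fin (l + 1) → Fin w,
      if ν (Fin.last l) = o then galuFc G Θ x 0 (Nat.zero_le _) (ν 0) *
        ∏ m : Fin l, (Θ (.fc ⟨m, by omega⟩ (ν m.castSucc) (ν m.succ)) *
          G.fc ⟨m, by omega⟩ (ν m.succ)) else 0 := by
  induction l generalizing o with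
  | zero =>
    rw [← (Equiv.funUnique (Fin 1) (Fin w)).symm.sum_comp]
    simp
  | succ l ih =>
    have h0 : ∀ (ν : Fin (l + 1) → Fin w) q, (Fin.snoc ν q : Fin (l + 2) → Fin w) 0 = ν 0 :=
      fun ν q => Fin.snoc_castSucc (α := fun _ => Fin w) q ν 0
    have hstep : galuFc G Θ x (l + 1) h o =
        fcLin Θ ⟨l, h⟩ (galuFc G Θ x l (by omega)) o * G.fc ⟨l, h⟩ o := rfl
    rw [hstep, sum_snoc]
    symm
    rw [Finset.sum_eq_single_of_mem o (Finset.mem_univ _) fun k _ hk => by simp [hk]]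
    simp only [fcLin, ih, Finset.sum_mul, Finset.mul_sum, Fin.snoc_last,
      Fin.prod_univ_castSucc, ← Fin.castSucc_succ, Fin.snoc_castSucc, Fin.succ_last,
      Fin.val_castSucc, Fin.val_last, h0, if_true]
    symm
    rw [Finset.sum_comm]
    refine Finset.sum_congr rfl fun p _ => ?_
    simp only [mul_ite, ite_mul, mul_zero, zero_mul, Finset.sum_ite_eq, Finset.mem_univ, if_true]
    ring

/-- The neural path feature for a given gating signal. -/
noncomputable def gatedFeature (G : Gates A w) (x : Input A) (b : Bundle A w) : ℝ :=
  ∑ j : Fin A.din, x (pathPos b j 0) *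
    ((∏ l : Fin A.dcv, G.conv l (pathPos b j (l.val + 1)) (b.2.1 l)) *
      ∏ l : Fin (A.dfc - 1), G.fc l (b.2.2 l))

/-- The pooled position `j` does not occur in any weight, so the sum over `j` can be moved inside,
where it assembles the feature of the bundle. -/
theorem galuOut_eq_sum (G : Gates A w) (Θ : Params A w) (x : Input A) :
    galuOut G Θ x = ∑ b : Bundle A w,
      gatedFeature G x b / A.din * ∏ l, Θ ((bundleSystem A w).edge b l) := by
  obtain ⟨din, wcv, dcv, dfc, h1, h2, h3, h4⟩ := A
  -- With successors in place of `dcv` and `dfc`, the truncated subtractions in the index types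
  -- reduce definitionally.
  obtain ⟨m, rfl⟩ : ∃ m, dcv = m + 1 := ⟨dcv - 1, by omega⟩
  obtain ⟨n, rfl⟩ : ∃ n, dfc = n + 1 := ⟨dfc - 1, by omega⟩
  let A : Arch := ⟨din, wcv, m + 1, n + 1, h1, h2, h3, h4⟩
  have hout : galuOut G Θ x = ∑ ν : Fin (n + 1) → Fin w,
      Θ (.out (ν (Fin.last n))) * (galuFc G Θ x 0 (Nat.zero_le _) (ν 0) *
        ∏ m : Fin n, (Θ (.fc m (ν m.castSucc) (ν m.succ)) * G.fc m (ν m.succ))) := by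
    change ∑ k, Θ (.out k) * galuFc G Θ x n le_rfl k = _
    have e := fun k => galuFc_eq_sum (A := A) G Θ x n le_rfl k
    simp only [e, Finset.mul_sum]
    rw [Finset.sum_comm]
    refine Finset.sum_congr rfl fun p _ => ?_
    simp only [mul_ite, mul_zero, Finset.sum_ite_eq, Finset.mem_univ, if_true]
    rfl
  have hpool : ∀ k, galuFc G Θ x 0 (Nat.zero_le _) k = ∑ i : Fin din,
      ∑ p : Fin (m + 1) → Fin wcv × Fin w, if (p (Fin.last m)).2 = k then
        convTerm (A := A) G Θ x m (Nat.lt_succ_self m) i p / din else 0 := by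
    intro k
    rw [galuFc, pool]
    refine Finset.sum_congr rfl fun i _ => ?_
    rw [galuConv_eq_sum, Finset.sum_mul]
    refine Finset.sum_congr rfl fun p _ => ?_
    rw [mul_one_div, ite_div, zero_div]
    rfl
  have hedge : ∀ (p : Fin (m + 1) → Fin wcv × Fin w) (ν : Fin n → Fin w),
      ∏ l, Θ ((bundleSystem A w).edge (fun l => (p l).1, fun l => (p l).2, ν) l) =
        (Θ (.first (p 0).1 (p 0).2) *
          ∏ l : Fin m, Θ (.conv l (p l.succ).1 (p l.castSucc).2 (p l.succ).2)) *
        (∏ l : Fin n, Θ (.fc l ((Fin.cons (p (Fin.last m)).2 ν : Fin (n + 1) → Fin w) l.castSucc)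
          ((Fin.cons (p (Fin.last m)).2 ν : Fin (n + 1) → Fin w) l.succ))) *
        Θ (.out ((Fin.cons (p (Fin.last m)).2 ν : Fin (n + 1) → Fin w) (Fin.last n))) := by
    intro p ν
    -- The last filter is also the input unit of the fully connected part, hence the `Fin.cons`.
    have hcons : ∀ l : Fin (n + 1), ∀ hl,
        bundleNode (A := A) (fun l => (p l).1, fun l => (p l).2, ν) (m + l) hl =
          (Fin.cons (p (Fin.last m)).2 ν : Fin (n + 1) → Fin w) l := by
      intro l hl
      cases l using Fin.cases with
      | zero => simp [bundleNode, A, Fin.last]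
      | succ l =>
        have : m + (l.val + 1) - (m + 1) = l.val := by omega
        simp [bundleNode, A, this]
    have hfirst : (bundleSystem A w).edge (fun l => (p l).1, fun l => (p l).2, ν)
        (Fin.castSucc (Fin.castAdd n (0 : Fin (m + 1)))) = .first (p 0).1 (p 0).2 := by
      simp [bundleSystem, bundleEdge, bundleNode, A]
    have hconv : ∀ l : Fin m, (bundleSystem A w).edge (fun l => (p l).1, fun l => (p l).2, ν)
        (Fin.castSucc (Fin.castAdd n l.succ)) =
          .conv l (p l.succ).1 (p l.castSucc).2 (p l.succ).2 := by
      intro l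
      have h1 : l.val < m + 1 := by omega
      simp [bundleSystem, bundleEdge, bundleNode, A, h1]
      exact ⟨rfl, rfl, rfl⟩
    have hfc : ∀ l : Fin n, (bundleSystem A w).edge (fun l => (p l).1, fun l => (p l).2, ν)
        (Fin.castSucc (Fin.natAdd (m + 1) l)) =
          .fc l ((Fin.cons (p (Fin.last m)).2 ν : Fin (n + 1) → Fin w) l.castSucc)
            ((Fin.cons (p (Fin.last m)).2 ν : Fin (n + 1) → Fin w) l.succ) := by
      intro l
      have h1 : m + 1 + l.val - 1 = m + l.castSucc.val := by rw [Fin.val_castSucc]; omega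
      have h2 : m + 1 + l.val = m + l.succ.val := by simp; omega
      have c1 := hcons l.castSucc (by simp [A]; omega)
      have c2 := hcons l.succ (by simp [A]; omega)
      have h3 : m + (l.val + 1) < m + 1 + n := by omega
      have h4 : m + (l.val + 1) - (m + 1) = l.val := by omega
      rw [← c1, ← c2]
      simp [bundleSystem, bundleEdge, A, h2, h3, h4]
    have hlast : (bundleSystem A w).edge (fun l => (p l).1, fun l => (p l).2, ν)
        (Fin.last (m + 1 + n)) =
          .out ((Fin.cons (p (Fin.last m)).2 ν : Fin (n + 1) → Fin w) (Fin.last n)) := by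
      have h1 : m + 1 + n - 1 = m + (Fin.last n).val := by rw [Fin.val_last]; omega
      have h2 : ¬ m + 1 + n ≤ m := by omega
      rw [← hcons (Fin.last n) (by simp [A])]
      simp [bundleSystem, bundleEdge, A, h1, h2]
    refine (Fin.prod_univ_castSucc (n := m + 1 + n) _).trans ?_
    rw [Fin.prod_univ_add (a := m + 1) (b := n), Fin.prod_univ_succ, hfirst, hlast]
    simp only [hconv, hfc]
  let e : (Fin (m + 1) → Fin wcv × Fin w) × (Fin n → Fin w) ≃ Bundle A w :=
    { toFun := fun t => (fun l => (t.1 l).1, fun l => (t.1 l).2, t.2)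
      invFun := fun b => (fun l => (b.1 l, b.2.1 l), b.2.2)
      left_inv := fun _ => rfl
      right_inv := fun _ => rfl }
  rw [← e.sum_comp, Fintype.sum_prod_type, hout, sum_cons]
  simp only [Fin.cons_zero, hpool, Finset.sum_mul, Finset.mul_sum]
  rw [Finset.sum_comm]
  symm
  rw [Finset.sum_comm]
  symm
  refine Finset.sum_congr rfl fun ν _ => ?_
  have hswap : ∀ f : Fin w → Fin din → (Fin (m + 1) → Fin wcv × Fin w) → ℝ,
      ∑ k, ∑ i, ∑ p, f k i p = ∑ p, ∑ k, ∑ i, f k i p := fun f =>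
    (Finset.sum_congr rfl fun _ _ => Finset.sum_comm).trans Finset.sum_comm
  rw [hswap]
  refine Finset.sum_congr rfl fun p _ => ?_
  -- Pooling preserves the channel: only the unit equal to the last filter of `p` survives.
  rw [Finset.sum_eq_single_of_mem (p (Fin.last m)).2 (Finset.mem_univ _)
    fun k _ hk => by simp [hk.symm]]
  rw [show e (p, ν) = (fun l => (p l).1, fun l => (p l).2, ν) from rfl, hedge, gatedFeature,
    Finset.sum_div, Finset.sum_mul]
  refine Finset.sum_congr rfl fun i _ => ?_
  have hterm : convTerm (A := A) G Θ x m (Nat.lt_succ_self m) i p =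
      (Θ (.first (p 0).1 (p 0).2) *
        ∏ l : Fin m, Θ (.conv l (p l.succ).1 (p l.castSucc).2 (p l.succ).2)) *
      ((∏ l : Fin (m + 1), G.conv l (convPos i p (l + 1)) (p l).2) * x (convPos i p 0)) := rfl
  simp only [if_true, hterm, Finset.prod_mul_distrib, Fin.cons_succ]
  change _ = x (convPos i p 0) *
    ((∏ l : Fin (m + 1), G.conv l (convPos i p (l + 1)) (p l).2) *
      ∏ l : Fin n, G.fc l (ν l)) / din * _
  ring

/-! ### Tangent kernel of a path sum -/

namespace PathSystem

variable {B I K : Type*} {N w : ℕ} (P : PathSystem B I K N w)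

theorem hasDerivAt_sum_paths [Fintype B] [DecidableEq I] (a : B → ℝ) (Θ : I → ℝ) (e : I) :
    HasDerivAt (fun t => ∑ b, a b * ∏ l, Function.update Θ e t (P.edge b l))
      (∑ b, a b * ∑ l, if P.edge b l = e then P.punctured Θ b l else 0) (Θ e) := by
  refine HasDerivAt.fun_sum fun b _ => HasDerivAt.const_mul _ ?_
  have h : ∀ l ∈ (Finset.univ : Finset (Fin (N + 1))),
      HasDerivAt (fun t => Function.update Θ e t (P.edge b l))
        (if P.edge b l = e then 1 else 0) (Θ e) := by
    intro l _
    split_ifs with hl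
    · simpa [hl] using hasDerivAt_id' (Θ e)
    · simpa [hl] using hasDerivAt_const (Θ e) (Θ (P.edge b l))
  convert HasDerivAt.fun_finsetProd h using 1
  simp [punctured]

/-- A weight lies in a single gap, so two paths that both contain `e` contain it in the same gap.
The terms are then split by whether the two paths are equal. -/
theorem sum_deriv_mul_deriv [Fintype B] [DecidableEq B] [Fintype I] [DecidableEq I]
    (a a' : B → ℝ) (Θ : I → ℝ) :
    ∑ e, (∑ b, a b * ∑ l, if P.edge b l = e then P.punctured Θ b l else 0) *
        (∑ b, a' b * ∑ l, if P.edge b l = e then P.punctured Θ b l else 0) =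
      (∑ b, a b * a' b * ∑ l, P.punctured Θ b l ^ 2) + P.offDiag a a' Θ := by
  have hpair : ∀ b b' : B, ∑ e, (∑ l, if P.edge b l = e then P.punctured Θ b l else 0) *
      (∑ l, if P.edge b' l = e then P.punctured Θ b' l else 0) =
      ∑ l, if P.edge b l = P.edge b' l then P.punctured Θ b l * P.punctured Θ b' l else 0 := by
    intro b b'
    simp only [Finset.sum_mul]
    rw [Finset.sum_comm]
    refine Finset.sum_congr rfl fun l _ => ?_
    simp only [ite_mul, zero_mul, Finset.sum_ite_eq, Finset.mem_univ, if_true]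
    rw [Finset.sum_eq_single_of_mem l (Finset.mem_univ _)
      fun k _ hk => if_neg fun h => hk (P.layer_eq _ _ _ _ h)]
    simp [eq_comm]
  have hall : ∑ e, (∑ b, a b * ∑ l, if P.edge b l = e then P.punctured Θ b l else 0) *
        (∑ b, a' b * ∑ l, if P.edge b l = e then P.punctured Θ b l else 0) =
      ∑ t : (B × B) × Fin (N + 1), if P.edge t.1.1 t.2 = P.edge t.1.2 t.2 then
        a t.1.1 * a' t.1.2 * (P.punctured Θ t.1.1 t.2 * P.punctured Θ t.1.2 t.2) else 0 := by
    simp only [Fintype.sum_prod_type, Finset.sum_mul_sum]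
    rw [Finset.sum_comm]
    refine Finset.sum_congr rfl fun b _ => ?_
    rw [Finset.sum_comm]
    refine Finset.sum_congr rfl fun b' _ => ?_
    simp only [mul_mul_mul_comm (a b), ← Finset.mul_sum, hpair, ← mul_ite_zero]
  have hdiag : (∑ b, a b * a' b * ∑ l, P.punctured Θ b l ^ 2) =
      ∑ t : (B × B) × Fin (N + 1), if t.1.1 = t.1.2 then
        a t.1.1 * a' t.1.2 * (P.punctured Θ t.1.1 t.2 * P.punctured Θ t.1.2 t.2) else 0 := by
    simp only [Fintype.sum_prod_type]
    refine Finset.sum_congr rfl fun b _ => ?_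
    rw [Finset.sum_comm, Finset.mul_sum]
    refine Finset.sum_congr rfl fun l _ => ?_
    simp [sq]
  rw [hall, hdiag, offDiag, Finset.sum_filter, ← Finset.sum_add_distrib]
  refine Finset.sum_congr rfl fun t _ => ?_
  by_cases h : t.1.1 = t.1.2
  · simp [h]
  · simp [h]

theorem punctured_sq {Θ σ : I → ℝ} (h : ∀ e, |Θ e| = |σ e|) (b : B) (l : Fin (N + 1)) :
    P.punctured Θ b l ^ 2 = ∏ k ∈ Finset.univ.erase l, σ (P.edge b k) ^ 2 := by
  rw [punctured, ← Finset.prod_pow]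
  exact Finset.prod_congr rfl fun k _ => sq_eq_sq_iff_abs_eq_abs _ _ |>.2 (h _)

end PathSystem

/-! ### Tangent kernel of the gated network -/

/-- At a point of differentiability `f` is continuous, and continuity with finitely many values
forces local constancy. Elsewhere `deriv` is 0 by default, matching the convention for the NTK. -/
theorem deriv_eq_zero_of_finite_range {f : ℝ → ℝ} (hf : (Set.range f).Finite) (t : ℝ) :
    deriv f t = 0 := by
  by_cases hd : DifferentiableAt ℝ f t
  · have hopen : IsOpen (Set.range f \ {f t})ᶜ := (hf.subset Set.sdiff_subset).isClosed.isOpen_compl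
    have hev : ∀ᶠ s in 𝓝 t, f s ∈ (Set.range f \ {f t})ᶜ :=
      hd.continuousAt.eventually_mem (hopen.mem_nhds (by simp))
    have heq : f =ᶠ[𝓝 t] fun _ => f t := by
      filter_upwards [hev] with s hs
      by_contra hne
      exact hs ⟨⟨s, rfl⟩, hne⟩
    rw [heq.deriv_eq, deriv_const]
  · exact deriv_zero_of_not_differentiableAt hd

theorem finite_range_gatesOf {ι : Type*} (Θ : ι → Params A w) (x : Input A) :
    (Set.range fun i => gatesOf (Θ i) x).Finite := by
  let g : (Fin A.dcv → Fin A.din → Fin w → Bool) × (Fin (A.dfc - 1) → Fin w → Bool) → Gates A w :=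
    fun s => ⟨fun l i o => if s.1 l i o then 1 else 0, fun l o => if s.2 l o then 1 else 0⟩
  refine (Set.finite_range g).subset ?_
  rintro _ ⟨i, rfl⟩
  exact ⟨(fun l j o => decide (0 < reluConvPre (Θ i) x l l.isLt j o),
    fun l o => decide (0 < reluFcPre (Θ i) x l l.isLt o)), by simp [g, gatesOf, hardGate]⟩

theorem partialDeriv_dgnOut_inl (Θf Θv : Params A w) (x : Input A) (e : WIdx A w) :
    partialDeriv (fun Θ => dgnOut Θ x) (Sum.elim Θf Θv) (.inl e) = 0 := by
  refine deriv_eq_zero_of_finite_range ?_ _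
  have h := (finite_range_gatesOf (fun t : ℝ => Function.update Θf e t) x).image
    fun G => galuOut G Θv x
  rw [← Set.range_comp] at h
  convert h using 2
  funext t
  simp only [dgnOut, Function.comp_apply]
  congr 2
  · funext e'
    by_cases he : e' = e
    · subst he; simp
    · simp [he]

theorem gatedFeature_gatesOf (Θ : Params A w) (x : Input A) (b : Bundle A w) :
    gatedFeature (gatesOf Θ x) x b = npf Θ x b := rfl

theorem partialDeriv_dgnOut_inr (Θf Θv : Params A w) (x : Input A) (e : WIdx A w) :
    partialDeriv (fun Θ => dgnOut Θ x) (Sum.elim Θf Θv) (.inr e) =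
      ∑ b, npf Θf x b / A.din * ∑ l, if (bundleSystem A w).edge b l = e then
        (bundleSystem A w).punctured Θv b l else 0 := by
  rw [← ((bundleSystem A w).hasDerivAt_sum_paths (fun b => npf Θf x b / A.din) Θv e).deriv]
  unfold partialDeriv
  congr 1
  funext t
  simp only [dgnOut, ← gatedFeature_gatesOf, ← galuOut_eq_sum]
  congr 1
  funext e'
  by_cases he : e' = e
  · subst he; simp
  · simp [he]

theorem ntkConv_eq (Θf Θv : Params A w) (x x' : Input A) :
    ntkConv (Sum.elim Θf Θv) x x' =
      (∑ b, npf Θf x b / A.din * (npf Θf x' b / A.din) *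
        ∑ l, (bundleSystem A w).punctured Θv b l ^ 2) +
      (bundleSystem A w).offDiag (fun b => npf Θf x b / A.din)
        (fun b => npf Θf x' b / A.din) Θv := by
  rw [← PathSystem.sum_deriv_mul_deriv, ntkConv, Fintype.sum_sum_type]
  simp [partialDeriv_dgnOut_inl, partialDeriv_dgnOut_inr]

theorem scale_edge (c : ℝ) (b : Bundle A w) (l : Fin (A.dcv + (A.dfc - 1) + 1)) :
    scale c ((bundleSystem A w).edge b l) =
      if l.val < A.dcv then sigmaCv A c w else sigmaFc c w := by
  have := A.dcv_pos
  simp only [bundleSystem, bundleEdge]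
  split_ifs <;> first | rfl | omega

/-- Puncturing one of the `m` gaps of the first kind removes a factor `S`, and one of the `n` others
a factor `F`. For `m = 0` or `n = 0` the truncated exponent has coefficient 0. -/
theorem sum_prod_erase_ite {m n : ℕ} {L : ℕ} (hL : L = m + n) (S F : ℝ) :
    ∑ l : Fin L, ∏ k ∈ Finset.univ.erase l, (if k.val < m then S else F) =
      m * S ^ (m - 1) * F ^ n + n * S ^ m * F ^ (n - 1) := by
  subst hL
  have hm : (Finset.univ.filter fun k : Fin (m + n) => k.val < m).card = m := by
    simp [Fin.card_filter_val_lt]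
  have hn : (Finset.univ.filter fun k : Fin (m + n) => ¬ k.val < m).card = n := by
    have := Finset.card_filter_add_card_filter_not (s := (Finset.univ : Finset (Fin (m + n))))
      (fun k => k.val < m)
    simp only [Finset.card_univ, Fintype.card_fin] at this
    omega
  have hl : ∀ l : Fin (m + n), ∏ k ∈ Finset.univ.erase l, (if k.val < m then S else F) =
      if l.val < m then S ^ (m - 1) * F ^ n else S ^ m * F ^ (n - 1) := by
    intro l
    rw [Finset.prod_ite, Finset.prod_const, Finset.prod_const, Finset.filter_erase,
      Finset.filter_erase]
    split_ifs with h
    · rw [Finset.card_erase_of_mem (by simpa using h), hm,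
        Finset.erase_eq_of_notMem (by simpa using h), hn]
    · rw [Finset.erase_eq_of_notMem (by simpa using h), hm,
        Finset.card_erase_of_mem (by simpa using h), hn]
  simp only [hl]
  rw [Finset.sum_ite, Finset.sum_const, Finset.sum_const, hm, hn]
  simp only [nsmul_eq_mul]
  ring

theorem sum_punctured_sq (c : ℝ) {Θ : Params A w} (h : ∀ e, |Θ e| = |scale c e|) (b : Bundle A w) :
    ∑ l, (bundleSystem A w).punctured Θ b l ^ 2 = betaCv A c w := by
  have hfc := A.dfc_pos
  simp only [PathSystem.punctured_sq _ h, scale_edge, ite_pow]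
  -- The output layer is counted among the `dfc` fully connected gaps, so there are `dcv + dfc` gaps
  -- in all.
  rw [sum_prod_erase_ite (m := A.dcv) (n := A.dfc) (by omega), betaCv]
  simp only [pow_mul]

theorem ntkConv_sub_eq_offDiag (c : ℝ) (Θf : Params A w) {Θv : Params A w}
    (h : ∀ e, |Θv e| = |scale c e|) (x x' : Input A) :
    ntkConv (Sum.elim Θf Θv) x x' - betaCv A c w / (A.din : ℝ) ^ 2 * npkConv Θf x x' =
      (bundleSystem A w).offDiag (fun b => npf Θf x b / A.din) (fun b => npf Θf x' b / A.din)
        Θv := by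
  rw [ntkConv_eq, npkConv, Finset.mul_sum, add_sub_right_comm, ← Finset.sum_sub_distrib,
    Finset.sum_eq_zero, zero_add]
  intro b _
  rw [sum_punctured_sq c h]
  ring

/-! ### Neural path features as random variables -/

theorem measurable_hardGate : Measurable hardGate :=
  Measurable.ite measurableSet_Ioi measurable_const measurable_const

theorem measurable_reluConvPre (x : Input A) (l : ℕ) (h : l < A.dcv) (i : Fin A.din) (o : Fin w) :
    Measurable fun Θ : Params A w => reluConvPre Θ x l h i o := by
  induction l generalizing i o with
  | zero =>
    simp only [reluConvPre, firstLin]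
    fun_prop
  | succ l ih =>
    have := fun h i o => measurable_hardGate.comp (ih h i o)
    simp only [Function.comp_def] at this
    simp only [reluConvPre, convLin]
    fun_prop

theorem measurable_reluPool (x : Input A) (o : Fin w) :
    Measurable fun Θ : Params A w => reluPool Θ x o := by
  have h1 := fun l h i => measurable_reluConvPre (w := w) x l h i o
  have h2 := fun l h i => measurable_hardGate.comp (h1 l h i)
  simp only [Function.comp_def] at h2
  simp only [reluPool, pool]
  fun_prop

theorem measurable_reluFcPre (x : Input A) (l : ℕ) (h : l < A.dfc - 1) (o : Fin w) :
    Measurable fun Θ : Params A w => reluFcPre Θ x l h o := by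
  induction l generalizing o with
  | zero =>
    have := measurable_reluPool (w := w) x
    simp only [reluFcPre, fcLin]
    fun_prop
  | succ l ih =>
    have := fun h o => measurable_hardGate.comp (ih h o)
    simp only [Function.comp_def] at this
    simp only [reluFcPre, fcLin]
    fun_prop

theorem measurable_npf (x : Input A) (b : Bundle A w) :
    Measurable fun Θ : Params A w => npf Θ x b := by
  have h1 := fun l h i o => measurable_hardGate.comp (measurable_reluConvPre (w := w) x l h i o)
  have h2 := fun l h o => measurable_hardGate.comp (measurable_reluFcPre (w := w) x l h o)
  simp only [Function.comp_def] at h1 h2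
  simp only [npf, pathActivity, gatesOf]
  fun_prop

theorem abs_hardGate_le (q : ℝ) : |hardGate q| ≤ 1 := by
  unfold hardGate
  split_ifs <;> simp

/-- A bundle has `din` paths, whatever the width; the bound must not grow with `w`. -/
theorem abs_npf_div_le (Θ : Params A w) (x : Input A) (b : Bundle A w) :
    |npf Θ x b / A.din| ≤ ∑ i, |x i| := by
  have hdin : (0 : ℝ) < A.din := by exact_mod_cast (Nat.zero_le _).trans_lt A.wcv_lt
  have hact : ∀ j, |pathActivity Θ x b j| ≤ 1 := by
    intro j
    rw [pathActivity, abs_mul, Finset.abs_prod, Finset.abs_prod]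
    exact mul_le_one₀ (Finset.prod_le_one (fun _ _ => abs_nonneg _) fun _ _ => abs_hardGate_le _)
      (Finset.prod_nonneg fun _ _ => abs_nonneg _)
      (Finset.prod_le_one (fun _ _ => abs_nonneg _) fun _ _ => abs_hardGate_le _)
  rw [abs_div, abs_of_pos hdin, div_le_iff₀ hdin]
  calc |npf Θ x b| ≤ ∑ j, |x (pathPos b j 0) * pathActivity Θ x b j| :=
        Finset.abs_sum_le_sum_abs _ _
    _ ≤ ∑ _j : Fin A.din, ∑ i, |x i| := by
        refine Finset.sum_le_sum fun j _ => ?_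
        rw [abs_mul]
        exact (mul_le_of_le_one_right (abs_nonneg _) (hact j)).trans
          (Finset.single_le_sum (f := fun i => |x i|) (fun _ _ => abs_nonneg _) (Finset.mem_univ _))
    _ = (∑ i, |x i|) * A.din := by simp [mul_comm]

/-! ### The rate -/

/-- Since `wcv ≥ 1`, the fully connected scale dominates, and one scale suffices for the upper
bound. -/
theorem abs_scale_le {c : ℝ} (hc : 0 < c) (e : WIdx A w) : |scale c e| ≤ sigmaFc c w := by
  have hfc : 0 ≤ sigmaFc c w := by unfold sigmaFc; positivity
  have hcv : |sigmaCv A c w| ≤ sigmaFc c w := by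
    have h1 : (1 : ℝ) ≤ A.wcv := by exact_mod_cast A.wcv_pos
    rw [abs_of_nonneg (by unfold sigmaCv; positivity), sigmaCv, sigmaFc]
    rcases Nat.eq_zero_or_pos w with rfl | hw
    · simp
    · have hw : (0 : ℝ) < w := by exact_mod_cast hw
      gcongr
      exact le_mul_of_one_le_right hw.le h1
  cases e
  · exact hcv
  · exact hcv
  · exact (abs_of_nonneg hfc).le
  · exact (abs_of_nonneg hfc).le

theorem sigmaFc_pow (c : ℝ) (w N : ℕ) :
    sigmaFc c w ^ (4 * N) = c ^ (4 * N) / (w : ℝ) ^ (2 * N) := by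
  rw [sigmaFc, div_pow, show 4 * N = 2 * (2 * N) by ring, pow_mul (√(w : ℝ)),
    Real.sq_sqrt (Nat.cast_nonneg w)]

/-- The `w ^ (2 * N)` of the count cancels against the scale; the saved factor `w` is what remains.
-/
theorem rate_le {N K w card : ℕ} (hw : 0 < w) (h : card * w ≤ N * (K ^ 4 * (3 * w ^ 2) ^ N))
    (R c : ℝ) (hc : 0 < c) :
    R ^ 4 * sigmaFc c w ^ (4 * N) * ((N + 1) ^ 2 * card) ≤
      R ^ 4 * c ^ (4 * N) * ((N + 1) ^ 2 * (N * (K ^ 4 * 3 ^ N))) / w := by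
  have hw' : (0 : ℝ) < w := by exact_mod_cast hw
  have h' : (card : ℝ) * w ≤ N * (K ^ 4 * (3 * w ^ 2) ^ N) := by exact_mod_cast h
  rw [sigmaFc_pow, le_div_iff₀ hw']
  calc R ^ 4 * (c ^ (4 * N) / (w : ℝ) ^ (2 * N)) * ((N + 1) ^ 2 * card) * w
      = R ^ 4 * c ^ (4 * N) * (N + 1) ^ 2 / (w : ℝ) ^ (2 * N) * (card * w) := by ring
    _ ≤ R ^ 4 * c ^ (4 * N) * (N + 1) ^ 2 / (w : ℝ) ^ (2 * N) *
          (N * (K ^ 4 * (3 * w ^ 2) ^ N)) := by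
        refine mul_le_mul_of_nonneg_left h' ?_
        positivity
    _ = _ := by
        rw [mul_pow, ← pow_mul]
        field_simp

theorem tendsto_measure_ge_of_tendsto_eLpNorm {Ω : ℕ → Type*} [∀ w, MeasurableSpace (Ω w)]
    {μ : ∀ w, Measure (Ω w)} {F : ∀ w, Ω w → ℝ} (hF : ∀ w, AEStronglyMeasurable (F w) (μ w))
    (h : Tendsto (fun w => eLpNorm (F w) 2 (μ w)) atTop (𝓝 0)) {ε : ℝ} (hε : 0 < ε) :
    Tendsto (fun w => μ w {ω | ε ≤ |F w ω|}) atTop (𝓝 0) := by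
  have hε' : ENNReal.ofReal ε ≠ 0 := by simpa using hε
  have hle : ∀ w, μ w {ω | ε ≤ |F w ω|} ≤
      (ENNReal.ofReal ε)⁻¹ ^ (2 : ℝ) * eLpNorm (F w) 2 (μ w) ^ (2 : ℝ) := by
    intro w
    have := meas_ge_le_mul_pow_eLpNorm_enorm (μ w) (p := 2) two_ne_zero ENNReal.ofNat_ne_top (hF w)
      hε' (by simp)
    rw [ENNReal.toReal_ofNat] at this
    convert this using 3
    ext ω
    rw [← ofReal_norm, ENNReal.ofReal_le_ofReal_iff (norm_nonneg _), Real.norm_eq_abs]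
  refine tendsto_of_tendsto_of_tendsto_of_le_of_le tendsto_const_nhds ?_ (fun _ => bot_le) hle
  have h2 : Tendsto (fun w => eLpNorm (F w) 2 (μ w) ^ (2 : ℝ)) atTop (𝓝 0) := by
    simpa using h.ennrpow_const 2
  simpa using ENNReal.Tendsto.const_mul h2
    (.inr (ENNReal.rpow_ne_top_of_nonneg (zero_le_two (α := ℝ)) (ENNReal.inv_ne_top.2 hε')))

theorem eLpNorm_two_le_of_integral_sq_le {Ω : Type*} [MeasurableSpace Ω] {μ : Measure Ω}
    {F : Ω → ℝ} (hF : MemLp F 2 μ) {r : ℝ} (h : ∫ ω, F ω ^ 2 ∂μ ≤ r) :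
    eLpNorm F 2 μ ≤ ENNReal.ofReal (√r) := by
  rw [hF.eLpNorm_eq_integral_rpow_norm two_ne_zero ENNReal.ofNat_ne_top, Real.sqrt_eq_rpow]
  refine ENNReal.ofReal_le_ofReal ?_
  simp only [ENNReal.toReal_ofNat, Real.rpow_ofNat, Real.norm_eq_abs, sq_abs, one_div]
  exact Real.rpow_le_rpow (integral_nonneg fun ω => sq_nonneg _) h (by norm_num)

end ConvDGN

theorem mainTheorem4 (A : ConvDGN.Arch) (c : ℝ) (hc : 0 < c)
    {Ω : ℕ → Type*} [∀ w, MeasurableSpace (Ω w)]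
    (μ : ∀ w, Measure (Ω w)) [∀ w, IsProbabilityMeasure (μ w)]
    (Θf Θv : ∀ w, Ω w → ConvDGN.Params A w)
    (hΘf : ∀ w, Measurable (Θf w)) (hΘv : ∀ w, Measurable (Θv w))
    (hlaw : ∀ w e, (μ w).map (fun ω => Θv w ω e) = ConvDGN.signLaw (ConvDGN.scale c e))
    (hiid : ∀ w, iIndepFun (fun e ω => Θv w ω e) (μ w))
    (hindep : ∀ w, IndepFun (Θf w) (Θv w) (μ w))
    (x x' : ConvDGN.Input A) :
    Tendsto (fun w => eLpNorm (fun ω =>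
        ConvDGN.ntkConv (Sum.elim (Θf w ω) (Θv w ω)) x x' -
          ConvDGN.betaCv A c w / (A.din : ℝ) ^ 2 * ConvDGN.npkConv (Θf w ω) x x') 2 (μ w))
      atTop (𝓝 0) ∧
    ∀ ε : ℝ, 0 < ε → Tendsto (fun w => μ w {ω | ε ≤
        |ConvDGN.ntkConv (Sum.elim (Θf w ω) (Θv w ω)) x x' -
          ConvDGN.betaCv A c w / (A.din : ℝ) ^ 2 * ConvDGN.npkConv (Θf w ω) x x'|})
      atTop (𝓝 0) := by
  classical
  let N := A.dcv + (A.dfc - 1)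
  let R : ℝ := ∑ i, |x i| + ∑ i, |x' i|
  let a : ∀ w, ConvDGN.Params A w → ConvDGN.Bundle A w → ℝ := fun w Θ b =>
    ConvDGN.npf Θ x b / A.din
  let a' : ∀ w, ConvDGN.Params A w → ConvDGN.Bundle A w → ℝ := fun w Θ b =>
    ConvDGN.npf Θ x' b / A.din
  have ha : ∀ w b, Measurable fun Θ => a w Θ b := fun w b =>
    (ConvDGN.measurable_npf x b).div_const _
  have ha' : ∀ w b, Measurable fun Θ => a' w Θ b := fun w b =>
    (ConvDGN.measurable_npf x' b).div_const _
  have hR : ∀ w Θ b, |a w Θ b| ≤ R := fun w Θ b =>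
    (ConvDGN.abs_npf_div_le Θ x b).trans
      (le_add_of_nonneg_right (Finset.sum_nonneg fun _ _ => abs_nonneg _))
  have hR' : ∀ w Θ b, |a' w Θ b| ≤ R := fun w Θ b =>
    (ConvDGN.abs_npf_div_le Θ x' b).trans
      (le_add_of_nonneg_left (Finset.sum_nonneg fun _ _ => abs_nonneg _))
  have hσ : ∀ w (e : ConvDGN.WIdx A w), |ConvDGN.scale c e| ≤ ConvDGN.sigmaFc c w :=
    fun w e => ConvDGN.abs_scale_le hc e
  let F : ∀ w, Ω w → ℝ := fun w ω =>
    (ConvDGN.bundleSystem A w).offDiag (a w (Θf w ω)) (a' w (Θf w ω)) (Θv w ω)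
  have hmem : ∀ w, MemLp (F w) 2 (μ w) := fun w =>
    (ConvDGN.bundleSystem A w).memLp_offDiag (hΘv w) (hlaw w) (hσ w) (hΘf w) (ha w) (ha' w) (hR w)
      (hR' w)
  have heq : ∀ w, (fun ω => ConvDGN.ntkConv (Sum.elim (Θf w ω) (Θv w ω)) x x' -
      ConvDGN.betaCv A c w / (A.din : ℝ) ^ 2 * ConvDGN.npkConv (Θf w ω) x x') =ᵐ[μ w] F w := by
    intro w
    have habs : ∀ᵐ ω ∂μ w, ∀ e, |Θv w ω e| = |ConvDGN.scale c e| := by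
      refine ae_all_iff.2 fun e => ae_of_ae_map ((measurable_pi_apply e).comp (hΘv w)).aemeasurable
        (p := fun y => |y| = |ConvDGN.scale c e|) ?_
      exact (hlaw w e).symm ▸ ConvDGN.ae_abs_eq_signLaw _
    filter_upwards [habs] with ω hω
    exact ConvDGN.ntkConv_sub_eq_offDiag c _ hω x x'
  let C : ℝ := R ^ 4 * c ^ (4 * N) *
    ((N + 1) ^ 2 * (N * ((Fintype.card (Fin A.dcv → Fin A.wcv) : ℝ) ^ 4 * 3 ^ N)))
  have hbound : ∀ w, 0 < w → eLpNorm (F w) 2 (μ w) ≤ ENNReal.ofReal (√(C / w)) := by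
    intro w hw
    refine ConvDGN.eLpNorm_two_le_of_integral_sq_le (hmem w) ?_
    have h := (ConvDGN.bundleSystem A w).integral_offDiag_sq_le (hΘv w) (hiid w) (hlaw w) (hσ w)
      (hΘf w) (hindep w) (ha w) (ha' w) (hR w) (hR' w)
    refine le_trans (le_of_eq ?_) (h.trans
      (ConvDGN.rate_le hw ((ConvDGN.bundleSystem A w).card_bad_mul_le) R c hc))
    -- The two integrands differ only in the decidability instances inside `offDiag`.
    congr!
  have hlim : Tendsto (fun w => eLpNorm (F w) 2 (μ w)) atTop (𝓝 0) := by
    have h0 : Tendsto (fun w : ℕ => ENNReal.ofReal (√(C / w))) atTop (𝓝 0) := by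
      have := ENNReal.tendsto_ofReal ((tendsto_const_div_atTop_nhds_zero_nat C).sqrt)
      simpa using this
    refine tendsto_of_tendsto_of_tendsto_of_le_of_le' tendsto_const_nhds h0
      (.of_forall fun _ => bot_le) ?_
    filter_upwards [eventually_gt_atTop 0] with w hw using hbound w hw
  have hmain : Tendsto (fun w => eLpNorm (fun ω =>
        ConvDGN.ntkConv (Sum.elim (Θf w ω) (Θv w ω)) x x' -
          ConvDGN.betaCv A c w / (A.din : ℝ) ^ 2 * ConvDGN.npkConv (Θf w ω) x x') 2 (μ w))
      atTop (𝓝 0) := by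
    simpa only [eLpNorm_congr_ae (heq _)] using hlim
  exact ⟨hmain, fun ε hε => ConvDGN.tendsto_measure_ge_of_tendsto_eLpNorm
    (fun w => (hmem w).1.congr (heq w).symm) hmain hε⟩
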